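/- **Setting.** Let $I$ be a finite set, $A=(a_{ij})_{i,j\in I}$ a symmetrizable generalized Cartan matrix ($a_{ii}=2$; $a_{ij}\le 0$ for $i\ne j$; $a_{ij}=0$ if $a_{ji}=0$), with chosen integers $d_i>0$ such that $d_ia_{ij}=d_ja_{ji}$. Let $P$ be a free abelian group of finite rank, with $\alpha_i\in P$ and $h_i\in\mathrm{Hom}(P,\mathbb Z)$ such that $\langle h_i,\alpha_j\rangle=a_{ij}$. Put $(\alpha_i|\alpha_j)=d_ia_{ij}$, and let $\Lambda\in P$ be dominant, i.e. $\langle h_i,\Lambda\rangle\ge 0$ for all $i$. Let $Q^+=\bigoplus_i\mathbb Z_{\ge0}\alpha_i$; the height of $\sum_j m_j\alpha_j$ is $\sum_j m_j$. Let $\mathbf k=\bigoplus_{m\in\mathbb Z}\mathbf k_m$ be a graded commutative ring with $\mathbf k_m=0$ for $m<0$. Let $Q_{ij}(u,v)\in\mathbf k[u,v]$ satisfy $Q_{ii}=0$, $Q_{ij}(u,v)=Q_{ji}(v,u)$ and, for $i\neq j$, $Q_{ij}=\sum_{p,q\ge 0}t_{i,j;p,q}u^pv^q$ with $t_{i,j;p,q}\in\mathbf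 k_{-2(\alpha_i|\alpha_j)-(\alpha_i|\alpha_i)p-(\alpha_j|\alpha_j)q}$ and $t_{i,j;-a_{ij},0}\in\mathbf k_0^\times$. For each $i$ let $a_i^\Lambda(u)=\sum_{m=0}^{\langle h_i,\Lambda\rangle}c_{i;m}u^{\langle h_i,\Lambda\rangle-m}$ with $c_{i;0}=1$ and $c_{i;m}\in\mathbf k_{m(\alpha_i|\alpha_i)}$. Let $R(n)$ be the Khovanov–Lauda–Rouquier algebra: the $\mathbf k$-algebra generated by $e(\nu)$ ($\nu\in I^n$), $x_k$ ($1\le k\le n$), $\tau_l$ ($1\le l\le n-1$) with the relations - $e(\nu)e(\nu')=\delta_{\nu,\nu'}e(\nu)$, $\sum_\nu e(\nu)=1$, $x_kx_l=x_lx_k$, $x_ke(\nu)=e(\nu)x_k$; - $\tau_le(\nu)=e(s_l\nu)\tau_l$, and $\tau_k\tau_l=\tau_l\tau_k$ if $|k-l|>1$; - $\tau_k^2e(\nu)=Q_{\nu_k,\nu_{k+1}}(x_k,x_{k+1})e(\nu)$; - $(\tau_kx_l-x_{s_k(l)}\tau_k)e(\nu)$ is $-e(\nu)$ if $l=k$ and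 $\nu_k=\nu_{k+1}$, is $e(\nu)$ if $l=k+1$ and $\nu_k=\nu_{k+1}$, and is $0$ otherwise; - $(\tau_{k+1}\tau_k\tau_{k+1}-\tau_k\tau_{k+1}\tau_k)e(\nu)$ is $\frac{Q_{\nu_k,\nu_{k+1}}(x_k,x_{k+1})-Q_{\nu_k,\nu_{k+1}}(x_{k+2},x_{k+1})}{x_k-x_{k+2}}e(\nu)$ if $\nu_k=\nu_{k+2}$, and $0$ otherwise. For $\beta\in Q^+$ of height $n$ let $I^\beta=\{\nu\in I^n:\sum_k\alpha_{\nu_k}=\beta\}$ (sum in $Q^+$), $e(\beta)=\sum_{\nu\in I^\beta}e(\nu)$ and $R(\beta)=R(n)e(\beta)$; let $e(\beta,i^\ell)\in R(\beta+\ell\alpha_i)$ be the sum of the $e(\nu)$ with $\nu\in I^{\beta+\ell\alpha_i}$ whose last $\ell$ entries are $i$. The algebra $R(\beta)$ is mapped to $e(\beta,i^\ell)R(\beta+\ell\alpha_i)e(\beta,i^\ell)$ by adding $\ell$ strands coloured $i$ on the right. Write $a^\Lambda(x_1)=\sum_{\nu\in I^\beta}a^\Lambda_{\nu_1}(x_1)e(\nu)\in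 R(\beta)$ (for each $\beta$ of positive height), and let $R^\Lambda(\beta)=R(\beta)/R(\beta)a^\Lambda(x_1)R(\beta)$. Fix $i\in I$ and $\beta\in Q^+$ of height $n$. Put $$K=e(\beta,i^2)R(\beta+2\alpha_i)e(\beta+\alpha_i,i)\otimes_{R(\beta+\alpha_i)}R^\Lambda(\beta+\alpha_i),$$ regard $w\in e(\beta,i^2)R(\beta+2\alpha_i)e(\beta+\alpha_i,i)$ as the element $w\otimes 1$ of $K$, and define additive subgroups $\Gamma_m\subset K$ ($m\in\mathbb Z$) by $\Gamma_m=0$ for $m<-1$, $$\Gamma_{-1}=R(\beta)\tau_n\tau_{n+1}e(\beta-\alpha_i,i^3)R^\Lambda(\beta+\alpha_i)+e(\beta,i^2)\tau_{n+1}R^\Lambda(\beta+\alpha_i)$$ (where the first summand is $0$ if $\beta-\alpha_i\notin Q^+$), and, for $m\ge0$, $$\Gamma_m=\Gamma_{m-1}+e(\beta,i^2)x_{n+2}^mR^\Lambda(\beta+\alpha_i)+e(\beta,i^2)\tau_{n+1}x_{n+2}^{m+1}R^\Lambda(\beta+\alpha_i).$$ **Proposition 5.7.** Let $p$ be the number of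 times $\alpha_i$ occurs in $\beta$ and $\lambda_i=\langle h_i,\Lambda-\beta\rangle$. Then $\lambda_i+2p\ge0$, and there exists a unit $c\in\mathbf k_0^\times$ such that, in $K$, $$\tau_{n+1}x_{n+2}^{\lambda_i+2p+1}e(\beta,i^2)\equiv c\,\tau_{n+1}\cdots\tau_1\,a^\Lambda(x_1)\,\tau_1\cdots\tau_{n+1}\,e(\beta,i^2)\,x_{n+2}^{2p+2}\pmod{\Gamma_{\lambda_i+2p-1}}.$$ -/

import Mathlib

open scoped TensorProduct

set_option linter.unusedSectionVars false

namespace KLR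

noncomputable section

/-! ### Cartan data, coefficient matrices and cyclotomic polynomials -/

/-- A Cartan datum on the (finite) index set `I` with weight lattice `P`; the co-weight lattice is
`Hom(P, ℤ)`.  The matrix `A` is a symmetrizable generalized Cartan matrix and `d` is the chosen
diagonal matrix with positive integer entries such that `diag(d) * A` is symmetric. -/
structure CartanDatum (I P : Type*) [AddCommGroup P] where
  A : Matrix I I ℤ
  diag : ∀ i, A i i = 2
  offDiag : ∀ i j, i ≠ j → A i j ≤ 0
  zero_symm : ∀ i j, A j i = 0 → A i j = 0
  d : I → ℕ
  d_pos : ∀ i, 0 < d i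
  symmetrizable : ∀ i j, (d i : ℤ) * A i j = (d j : ℤ) * A j i
  /-- the simple roots `α_i` -/
  root : I → P
  /-- the simple coroots `h_i` -/
  coroot : I → Module.Dual ℤ P
  pairing : ∀ i j, coroot i (root j) = A i j

section CartanDatum

variable {I P : Type*} [AddCommGroup P]

/-- The value `(α_i | α_j) = d_i a_{ij}` of the symmetric bilinear form on simple roots. -/
def CartanDatum.form (D : CartanDatum I P) (i j : I) : ℤ := (D.d i : ℤ) * D.A i j

/-- Dominant integral weights. -/
def CartanDatum.IsDominant (D : CartanDatum I P) (Λ : P) : Prop := ∀ i, 0 ≤ D.coroot i Λ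

/-- The image in `P` of an element `β = ∑ β_j α_j` of `Q⁺`.  An element of
`Q⁺ = ⨁ ℤ_{≥ 0} α_j` is given by its family of multiplicities `β : I → ℕ`. -/
def CartanDatum.toWeight [Fintype I] (D : CartanDatum I P) (β : I → ℕ) : P :=
  ∑ j, β j • D.root j

/-- `c` is a unit of the degree zero part of the graded ring `k`. -/
def IsUnitDegZero {k : Type*} [CommRing k] (𝒜 : ℤ → AddSubgroup k) (c : k) : Prop :=
  c ∈ 𝒜 0 ∧ ∃ c' ∈ 𝒜 0, c * c' = 1

/-- A matrix `(Q_{ij})` of polynomials in `k[u, v]` (`u` is the variable `0`, `v` the variable `1`)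
as used to define a Khovanov-Lauda-Rouquier algebra. -/
structure QMatrix (D : CartanDatum I P) {k : Type*} [CommRing k] (𝒜 : ℤ → AddSubgroup k) where
  Q : I → I → MvPolynomial (Fin 2) k
  diag : ∀ i, Q i i = 0
  symm : ∀ i j, Q i j = MvPolynomial.rename (Equiv.swap (0 : Fin 2) 1) (Q j i)
  /-- `t_{i,j;p,q}` has degree `-2(α_i|α_j) - (α_i|α_i)p - (α_j|α_j)q` -/
  coeff_mem : ∀ i j, i ≠ j → ∀ m : Fin 2 →₀ ℕ, MvPolynomial.coeff m (Q i j) ∈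
    𝒜 (-2 * D.form i j - D.form i i * (m 0 : ℤ) - D.form j j * (m 1 : ℤ))
  /-- `t_{i,j} = t_{i,j;-a_{ij},0}` is a unit of `k_0` (note that `-a_{ij} ≥ 0` for `i ≠ j`) -/
  coeff_unit : ∀ i j, i ≠ j →
    IsUnitDegZero 𝒜 (MvPolynomial.coeff (Finsupp.single 0 (-D.A i j).toNat) (Q i j))

/-- The coefficients `c_{i;m}` (`0 ≤ m ≤ ⟨h_i, Λ⟩`) of the monic polynomials `a_i^Λ(u)`. -/
structure CycCoeff (D : CartanDatum I P) {k : Type*} [CommRing k] (𝒜 : ℤ → AddSubgroup k)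
    (Λ : P) where
  c : I → ℕ → k
  zero : ∀ i, c i 0 = 1
  mem : ∀ i (m : ℕ), (m : ℤ) ≤ D.coroot i Λ → c i m ∈ 𝒜 ((m : ℤ) * D.form i i)

/-- The polynomial `a_i^Λ(u) = ∑_{m = 0}^{⟨h_i, Λ⟩} c_{i;m} u^{⟨h_i, Λ⟩ - m}`
(for dominant `Λ`, so that `⟨h_i, Λ⟩ ≥ 0`). -/
def CycCoeff.poly {D : CartanDatum I P} {k : Type*} [CommRing k] {𝒜 : ℤ → AddSubgroup k} {Λ : P}
    (a : CycCoeff D 𝒜 Λ) (i : I) : Polynomial k :=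
  ∑ m ∈ Finset.range ((D.coroot i Λ).toNat + 1),
    Polynomial.monomial ((D.coroot i Λ).toNat - m) (a.c i m)

end CartanDatum

/-! ### Polynomials in two elements of a noncommutative algebra -/

section Poly

variable {k A : Type*} [CommRing k] [Ring A] [Algebra k A]

/-- `q(u, v) = ∑ t_{p,r} u^p v^r`. -/
def evalPair (q : MvPolynomial (Fin 2) k) (u v : A) : A :=
  ∑ m ∈ q.support, MvPolynomial.coeff m q • (u ^ m 0 * v ^ m 1)

/-- The divided difference `(q(u, v) - q(w, v)) / (u - w)`, that is
`∑ t_{p,r} (∑_{a < p} u^a w^{p-1-a}) v^r`. -/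
def divDiff (q : MvPolynomial (Fin 2) k) (u w v : A) : A :=
  ∑ m ∈ q.support, MvPolynomial.coeff m q •
    ((∑ a ∈ Finset.range (m 0), u ^ a * w ^ (m 0 - 1 - a)) * v ^ m 1)

end Poly

/-! ### The algebra `R(n)`

Positions are numbered from `0`: the elements `x_1, …, x_n` are `x 0, …, x (n - 1)`, and
`τ_1, …, τ_{n-1}` are `tau 0, …, tau (n - 2)`; `tau l` crosses the positions `l` and `l + 1`. -/

section Algebra

/-- The generators of `R(n)`. -/
inductive Gen (I : Type*) (n : ℕ) where
  | e (ν : Fin n → I) : Gen I n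
  | x (l : Fin n) : Gen I n
  | tau (l : ℕ) (h : l + 1 < n) : Gen I n

variable {I k : Type*} [Fintype I] [DecidableEq I] [CommRing k]

/-- The simple transposition exchanging the positions `l` and `l + 1`. -/
def sPerm {n : ℕ} (l : ℕ) (h : l + 1 < n) : Equiv.Perm (Fin n) :=
  Equiv.swap ⟨l, by omega⟩ ⟨l + 1, h⟩

/-- The free generators, as elements of the free algebra. -/
def fe (k : Type*) [CommRing k] {I : Type*} {n : ℕ} (ν : Fin n → I) : FreeAlgebra k (Gen I n) :=
  FreeAlgebra.ι k (Gen.e ν)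

def fx (k I : Type*) [CommRing k] {n : ℕ} (l : Fin n) : FreeAlgebra k (Gen I n) :=
  FreeAlgebra.ι k (Gen.x l)

def ft (k I : Type*) [CommRing k] {n : ℕ} (l : ℕ) (h : l + 1 < n) : FreeAlgebra k (Gen I n) :=
  FreeAlgebra.ι k (Gen.tau l h)

/-- The defining relations of `R(n)`. -/
inductive Rel (Q : I → I → MvPolynomial (Fin 2) k) (n : ℕ) :
    FreeAlgebra k (Gen I n) → FreeAlgebra k (Gen I n) → Prop
  | e_mul_e (ν ν' : Fin n → I) :
      Rel Q n (fe k ν * fe k ν') (if ν = ν' then fe k ν else 0)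
  | sum_e : Rel Q n (∑ ν : Fin n → I, fe k ν) 1
  | x_mul_x (l m : Fin n) : Rel Q n (fx k I l * fx k I m) (fx k I m * fx k I l)
  | x_mul_e (l : Fin n) (ν : Fin n → I) : Rel Q n (fx k I l * fe k ν) (fe k ν * fx k I l)
  | tau_mul_e (l : ℕ) (h : l + 1 < n) (ν : Fin n → I) :
      Rel Q n (ft k I l h * fe k ν) (fe k (ν ∘ sPerm l h) * ft k I l h)
  | tau_mul_tau (l m : ℕ) (hl : l + 1 < n) (hm : m + 1 < n) (hlm : l + 1 < m) :
      Rel Q n (ft k I l hl * ft k I m hm) (ft k I m hm * ft k I l hl)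
  | tau_sq (l : ℕ) (h : l + 1 < n) (ν : Fin n → I) :
      Rel Q n (ft k I l h * ft k I l h * fe k ν)
        (evalPair (Q (ν ⟨l, by omega⟩) (ν ⟨l + 1, h⟩))
          (fx k I ⟨l, by omega⟩) (fx k I ⟨l + 1, h⟩) * fe k ν)
  | tau_mul_x (l : ℕ) (h : l + 1 < n) (m : Fin n) (ν : Fin n → I) :
      Rel Q n ((ft k I l h * fx k I m - fx k I (sPerm l h m) * ft k I l h) * fe k ν)
        (if (m : ℕ) = l ∧ ν ⟨l, by omega⟩ = ν ⟨l + 1, h⟩ then -fe k ν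
          else if (m : ℕ) = l + 1 ∧ ν ⟨l, by omega⟩ = ν ⟨l + 1, h⟩ then fe k ν
          else 0)
  | braid (l : ℕ) (h : l + 1 + 1 < n) (ν : Fin n → I) :
      Rel Q n
        ((ft k I (l + 1) h * ft k I l (by omega) * ft k I (l + 1) h
          - ft k I l (by omega) * ft k I (l + 1) h * ft k I l (by omega)) * fe k ν)
        (if ν ⟨l, by omega⟩ = ν ⟨l + 2, h⟩ then
          divDiff (Q (ν ⟨l, by omega⟩) (ν ⟨l + 1, by omega⟩))
            (fx k I ⟨l, by omega⟩) (fx k I ⟨l + 2, h⟩) (fx k I ⟨l + 1, by omega⟩) * fe k ν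
          else 0)

/-- The Khovanov-Lauda-Rouquier algebra `R(n)`. -/
def Alg (Q : I → I → MvPolynomial (Fin 2) k) (n : ℕ) : Type _ := RingQuot (Rel Q n)

instance (Q : I → I → MvPolynomial (Fin 2) k) (n : ℕ) : Ring (Alg Q n) :=
  inferInstanceAs (Ring (RingQuot (Rel Q n)))

instance (Q : I → I → MvPolynomial (Fin 2) k) (n : ℕ) : Algebra k (Alg Q n) :=
  inferInstanceAs (Algebra k (RingQuot (Rel Q n)))

variable (Q : I → I → MvPolynomial (Fin 2) k) {n : ℕ}

/-- The quotient map from the free algebra. -/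
def Alg.mk (n : ℕ) : FreeAlgebra k (Gen I n) →ₐ[k] Alg Q n := RingQuot.mkAlgHom k (Rel Q n)

/-- The idempotents `e(ν)`. -/
def e (ν : Fin n → I) : Alg Q n := Alg.mk Q n (fe k ν)

/-- The elements `x_{l+1}`. -/
def x (l : Fin n) : Alg Q n := Alg.mk Q n (fx k I l)

/-- The elements `τ_{l+1}`. -/
def tau (l : ℕ) (h : l + 1 < n) : Alg Q n := Alg.mk Q n (ft k I l h)

variable {Q}

theorem mk_rel {a b : FreeAlgebra k (Gen I n)} (h : Rel Q n a b) : Alg.mk Q n a = Alg.mk Q n b :=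
  RingQuot.mkAlgHom_rel k h

theorem map_evalPair {A B : Type*} [Ring A] [Algebra k A] [Ring B] [Algebra k B] (f : A →ₐ[k] B)
    (q : MvPolynomial (Fin 2) k) (u v : A) : f (evalPair q u v) = evalPair q (f u) (f v) := by
  simp [evalPair]

theorem map_divDiff {A B : Type*} [Ring A] [Algebra k A] [Ring B] [Algebra k B] (f : A →ₐ[k] B)
    (q : MvPolynomial (Fin 2) k) (u w v : A) :
    f (divDiff q u w v) = divDiff q (f u) (f w) (f v) := by
  simp [divDiff]

theorem e_mul_e (ν ν' : Fin n → I) : e Q ν * e Q ν' = if ν = ν' then e Q ν else 0 := by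
  have := mk_rel (Rel.e_mul_e (Q := Q) ν ν')
  rw [map_mul] at this
  rw [e, e, this]
  split_ifs <;> simp

/-! ### Weights, idempotents, and the algebras `R(β)` and `R^Λ(β)` -/

/-- The weight `∑_l α_{ν_l}` in `Q⁺` of a sequence `ν`; thus `I^β` is `{ν | wt ν = β}`. -/
def wt (ν : Fin n → I) : I → ℕ := ∑ l, Pi.single (ν l) 1

theorem sum_e_idem (s : Finset (Fin n → I)) :
    IsIdempotentElem (∑ ν ∈ s, e Q ν) := by
  rw [IsIdempotentElem, Finset.sum_mul_sum]
  refine Finset.sum_congr rfl fun ν hν => ?_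
  simp [e_mul_e, hν]

variable (Q) in
/-- `e(β) = ∑_{ν ∈ I^β} e(ν)` in `R(n)` (where `n` is the height of `β`). -/
def eWt (n : ℕ) (β : I → ℕ) : Alg Q n := ∑ ν : Fin n → I with wt ν = β, e Q ν

variable (Q) in
/-- `e(β, i^ℓ)` in `R(n)`, where `n` is the height of `β + ℓ α_i`: the sum of the `e(ν)` over the
sequences `ν` of weight `β + ℓ α_i` whose last `ℓ` entries are equal to `i`. -/
def eTail (n : ℕ) (β : I → ℕ) (i : I) (ℓ : ℕ) : Alg Q n :=
  ∑ ν : Fin n → I with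
    (wt ν = β + Pi.single i ℓ ∧ ∀ l : Fin n, n ≤ (l : ℕ) + ℓ → ν l = i), e Q ν

theorem eWt_idem (n : ℕ) (β : I → ℕ) : IsIdempotentElem (eWt Q n β) := sum_e_idem _

variable (Q) in
/-- `R(β) = R(n) e(β)`, a ring with unit `e(β)`, for `n` the height of `β`.  (As `e(β)` is a central
idempotent of `R(n)`, this is `e(β) R(n) e(β)`.) -/
abbrev RBeta (n : ℕ) (β : I → ℕ) : Type _ := (eWt_idem (Q := Q) n β).Corner

/-- The element `a^Λ(x_{l+1}) = ∑_{ν ∈ I^β} a_{ν_{l+1}}(x_{l+1}) e(ν)`, as an element of `R(n)`. -/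
def cyc (Q : I → I → MvPolynomial (Fin 2) k) (a : I → Polynomial k) (β : I → ℕ) (l : Fin n) :
    Alg Q n :=
  ∑ ν : Fin n → I with wt ν = β, Polynomial.aeval (x Q l) (a (ν l)) * e Q ν

/-- The two-sided ideal of `R(β)` generated by `a^Λ(x_1)` (the zero ideal if `n = 0`). -/
def cycIdeal (Q : I → I → MvPolynomial (Fin 2) k) (a : I → Polynomial k) (n : ℕ) (β : I → ℕ) :
    TwoSidedIdeal (RBeta Q n β) :=
  TwoSidedIdeal.span {r | ∃ h : 0 < n, r.1 = cyc Q a β (⟨0, h⟩ : Fin n)}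

/-- The cyclotomic Khovanov-Lauda-Rouquier algebra `R^Λ(β) = R(β) / R(β) a^Λ(x_1) R(β)`. -/
abbrev RLambda (Q : I → I → MvPolynomial (Fin 2) k) (a : I → Polynomial k) (n : ℕ) (β : I → ℕ) :
    Type _ :=
  (cycIdeal Q a n β).ringCon.Quotient

/-! ### The embedding `R(n) → R(n + 1)` -/

/-- The images of the generators under `R(n) → R(n + 1)`. -/
def embGen (Q : I → I → MvPolynomial (Fin 2) k) (n : ℕ) : Gen I n → Alg Q (n + 1)
  | .e ν => ∑ j : I, e Q (Fin.snoc ν j : Fin (n + 1) → I)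
  | .x l => x Q l.castSucc
  | .tau l h => tau Q l (by omega)

variable (Q) in
/-- The induced homomorphism from the free algebra. -/
def embFree (n : ℕ) : FreeAlgebra k (Gen I n) →ₐ[k] Alg Q (n + 1) :=
  FreeAlgebra.lift k (embGen Q n)

theorem embFree_e (ν : Fin n → I) :
    embFree Q n (fe k ν) = ∑ j : I, e Q (Fin.snoc ν j : Fin (n + 1) → I) := by
  simp [embFree, fe, embGen]

theorem embFree_x (l : Fin n) : embFree Q n (fx k I l) = x Q l.castSucc := by
  simp [embFree, fx, embGen]

theorem embFree_t (l : ℕ) (h : l + 1 < n) :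
    embFree Q n (ft k I l h) = tau Q l (by omega : l + 1 < n + 1) := by
  simp [embFree, ft, embGen]

theorem mk_fe (ν : Fin n → I) : Alg.mk Q n (fe k ν) = e Q ν := rfl

theorem mk_fx (l : Fin n) : Alg.mk Q n (fx k I l) = x Q l := rfl

theorem mk_ft (l : ℕ) (h : l + 1 < n) : Alg.mk Q n (ft k I l h) = tau Q l h := rfl

theorem sPerm_castSucc (l : ℕ) (h : l + 1 < n) (m : Fin n) :
    (sPerm l h m).castSucc = sPerm l (by omega : l + 1 < n + 1) m.castSucc := by
  simp only [sPerm, Equiv.swap_apply_def, Fin.ext_iff, Fin.val_castSucc]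
  split_ifs <;> simp_all

theorem sPerm_last (l : ℕ) (h : l + 1 < n) :
    sPerm l (by omega : l + 1 < n + 1) (Fin.last n) = Fin.last n := by
  apply Equiv.swap_apply_of_ne_of_ne <;> simp only [ne_eq, Fin.ext_iff, Fin.val_last] <;> omega

theorem snoc_comp_sPerm (ν : Fin n → I) (j : I) (l : ℕ) (h : l + 1 < n) :
    (Fin.snoc (ν ∘ sPerm l h) j : Fin (n + 1) → I) =
      (Fin.snoc ν j : Fin (n + 1) → I) ∘ sPerm l (by omega : l + 1 < n + 1) := by
  funext m
  induction m using Fin.lastCases with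
  | last => rw [Function.comp_apply, sPerm_last l h, Fin.snoc_last, Fin.snoc_last]
  | cast m =>
    rw [Function.comp_apply, ← sPerm_castSucc l h, Fin.snoc_castSucc, Fin.snoc_castSucc]
    rfl

theorem snoc_mk (ν : Fin n → I) (j : I) (l : ℕ) (h : l < n) :
    (Fin.snoc ν j : Fin (n + 1) → I) ⟨l, by omega⟩ = ν ⟨l, h⟩ :=
  Fin.snoc_castSucc (α := fun _ => I) j ν ⟨l, h⟩

theorem embFree_rel {a b : FreeAlgebra k (Gen I n)} (h : Rel Q n a b) :
    embFree Q n a = embFree Q n b := by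
  cases h with
  | e_mul_e ν ν' =>
    rw [map_mul, embFree_e, embFree_e, Finset.sum_mul_sum]
    simp only [e_mul_e, Fin.snoc_inj]
    by_cases hν : ν = ν' <;> simp [hν, embFree_e]
  | sum_e =>
    have := mk_rel (Rel.sum_e (Q := Q) (n := n + 1))
    simp only [map_sum, map_one, mk_fe] at this
    rw [map_sum, map_one, ← this, ← (Fin.snocEquiv fun _ => I).sum_comp, Fintype.sum_prod_type,
      Finset.sum_comm]
    simp only [embFree_e]
    rfl
  | x_mul_x l m =>
    simpa only [map_mul, embFree_x, mk_fx] using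
      mk_rel (Rel.x_mul_x (Q := Q) l.castSucc m.castSucc)
  | x_mul_e l ν =>
    simp only [map_mul, embFree_x, embFree_e, Finset.mul_sum, Finset.sum_mul]
    refine Finset.sum_congr rfl fun j _ => ?_
    simpa only [map_mul, mk_fx, mk_fe] using mk_rel (Rel.x_mul_e (Q := Q) l.castSucc (Fin.snoc ν j))
  | tau_mul_e l h ν =>
    simp only [map_mul, embFree_t, embFree_e, Finset.mul_sum, Finset.sum_mul, snoc_comp_sPerm]
    refine Finset.sum_congr rfl fun j _ => ?_
    have := mk_rel (Rel.tau_mul_e (Q := Q) l (by omega : l + 1 < n + 1) (Fin.snoc ν j))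
    rw [map_mul, map_mul] at this
    exact this
  | tau_mul_tau l m hl hm hlm =>
    have := mk_rel (Rel.tau_mul_tau (Q := Q) l m
      (by omega : l + 1 < n + 1) (by omega : m + 1 < n + 1) hlm)
    rw [map_mul, map_mul] at this
    rw [map_mul, map_mul, embFree_t, embFree_t]
    exact this
  | tau_sq l h ν =>
    simp only [map_mul, embFree_t, embFree_e, Finset.mul_sum, map_evalPair, embFree_x]
    refine Finset.sum_congr rfl fun j _ => ?_
    have := mk_rel (Rel.tau_sq (Q := Q) l (by omega : l + 1 < n + 1) (Fin.snoc ν j))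
    simp only [map_mul, map_evalPair, snoc_mk _ _ l (by omega : l < n),
      snoc_mk _ _ (l + 1) h] at this
    exact this
  | tau_mul_x l h m ν =>
    have key : ∀ j : I, _ := fun j => mk_rel
      (Rel.tau_mul_x (Q := Q) l (by omega : l + 1 < n + 1) m.castSucc (Fin.snoc ν j))
    simp only [map_mul, map_sub, mk_ft, mk_fe, mk_fx, snoc_mk _ _ l (by omega : l < n),
      snoc_mk _ _ (l + 1) h, ← sPerm_castSucc l h, Fin.val_castSucc] at key
    simp only [map_mul, map_sub, embFree_t, embFree_e, embFree_x, Finset.mul_sum, key]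
    split_ifs <;> simp [embFree_e, mk_fe]
  | braid l h ν =>
    have key : ∀ j : I, _ := fun j => mk_rel
      (Rel.braid (Q := Q) l (by omega : l + 1 + 1 < n + 1) (Fin.snoc ν j))
    simp only [map_mul, map_sub, mk_ft, mk_fe, snoc_mk _ _ l (by omega : l < n),
      snoc_mk _ _ (l + 1) (by omega : l + 1 < n), snoc_mk _ _ (l + 2) h] at key
    simp only [map_mul, map_sub, embFree_t, embFree_e, Finset.mul_sum, key]
    split_ifs <;>
      simp [embFree_e, embFree_x, mk_fe, mk_fx, map_divDiff, Finset.mul_sum]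

variable (Q) in
/-- The algebra homomorphism `R(n) → R(n + 1)` sending `e(ν)` to `∑_j e(ν, j)`, `x_l` to `x_l` and
`τ_l` to `τ_l`. -/
def emb (n : ℕ) : Alg Q n →ₐ[k] Alg Q (n + 1) :=
  RingQuot.liftAlgHom k ⟨embFree Q n, fun _ _ h => embFree_rel h⟩

/-! ### The bimodule `K` and its filtration

Here `n` is the height of `β`, and the ambient algebra is `R(n + 2)`. -/

variable (Q) in
/-- `e(β, i²) R(β + 2α_i) e(β + α_i, i)`, as a submodule of `R(n + 2)`. -/
def leftFactor (n : ℕ) (β : I → ℕ) (i : I) : Submodule k (Alg Q (n + 2)) :=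
  LinearMap.range
    (LinearMap.mulLeft k (eTail Q (n + 2) β i 2) ∘ₗ
      LinearMap.mulRight k (eTail Q (n + 2) (β + Pi.single i 1) i 1))

/-- The element `e(β, i²) w e(β + α_i, i)`, for `w` in `R(n + 2)`. -/
def toLeft (n : ℕ) (β : I → ℕ) (i : I) (w : Alg Q (n + 2)) : leftFactor Q n β i :=
  ⟨eTail Q (n + 2) β i 2 * (w * eTail Q (n + 2) (β + Pi.single i 1) i 1), w, rfl⟩

/-- The right action of `R(β + α_i)` on `e(β, i²) R(β + 2α_i) e(β + α_i, i)`, through the embedding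
`r ↦ r e(β + α_i, i)` of `R(β + α_i)` into `e(β + α_i, i) R(β + 2α_i) e(β + α_i, i)`. -/
def rightAct (n : ℕ) (β : I → ℕ) (i : I) (z : leftFactor Q n β i)
    (r : RBeta Q (n + 1) (β + Pi.single i 1)) : leftFactor Q n β i :=
  toLeft n β i (z.1 * emb Q (n + 1) r.1)

/-- The tensor product
`K = e(β, i²) R(β + 2α_i) e(β + α_i, i) ⊗_{R(β + α_i)} R^Λ(β + α_i)`: the quotient of the tensor
product over `ℤ` by the subgroup generated by the elements `(z r) ⊗ s - z ⊗ (r s)`. -/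
abbrev K (Q : I → I → MvPolynomial (Fin 2) k) (a : I → Polynomial k) (n : ℕ) (β : I → ℕ) (i : I) :
    Type _ :=
  (leftFactor Q n β i ⊗[ℤ] RLambda Q a (n + 1) (β + Pi.single i 1)) ⧸
    AddSubgroup.closure
      {t : leftFactor Q n β i ⊗[ℤ] RLambda Q a (n + 1) (β + Pi.single i 1) |
        ∃ (z : leftFactor Q n β i) (r : RBeta Q (n + 1) (β + Pi.single i 1))
          (s : RLambda Q a (n + 1) (β + Pi.single i 1)),
          t = rightAct n β i z r ⊗ₜ[ℤ] s -
            z ⊗ₜ[ℤ] ((r : RLambda Q a (n + 1) (β + Pi.single i 1)) * s)}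

/-- The element `w ⊗ s` of `K` (more precisely `e(β, i²) w e(β + α_i, i) ⊗ s`), for `w` in
`R(n + 2)` and `s` in `R^Λ(β + α_i)`. -/
def K.tmul (a : I → Polynomial k) (β : I → ℕ) (i : I) (w : Alg Q (n + 2))
    (s : RLambda Q a (n + 1) (β + Pi.single i 1)) : K Q a n β i :=
  QuotientAddGroup.mk (toLeft n β i w ⊗ₜ[ℤ] s)

variable (Q) in
/-- `Γ_{-1} = R(β) τ_n τ_{n+1} e(β - α_i, i³) R^Λ(β + α_i) + e(β, i²) τ_{n+1} R^Λ(β + α_i)`;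
the first summand is `0` if `β - α_i` is not in `Q⁺`. -/
def gammaNegOne (a : I → Polynomial k) (n : ℕ) (β : I → ℕ) (i : I) : AddSubgroup (K Q a n β i) :=
  AddSubgroup.closure
    {t | ∃ (h : 0 < n) (γ : I → ℕ) (_ : γ + Pi.single i 1 = β) (r : RBeta Q n β)
      (s : RLambda Q a (n + 1) (β + Pi.single i 1)),
      t = K.tmul a β i (emb Q (n + 1) (emb Q n r.1) *
        tau Q (n - 1) (by omega) * tau Q n (by omega) * eTail Q (n + 2) γ i 3) s} ⊔
  AddSubgroup.closure
    {t | ∃ s : RLambda Q a (n + 1) (β + Pi.single i 1),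
      t = K.tmul a β i (eTail Q (n + 2) β i 2 * tau Q n (by omega)) s}

variable (Q) in
/-- `gammaAux m` is the filtration piece `Γ_{m-1}`, where
`Γ_m = Γ_{m-1} + e(β, i²) x_{n+2}^m R^Λ(β + α_i) + e(β, i²) τ_{n+1} x_{n+2}^{m+1} R^Λ(β + α_i)`
for `m ≥ 0`. -/
def gammaAux (a : I → Polynomial k) (n : ℕ) (β : I → ℕ) (i : I) : ℕ → AddSubgroup (K Q a n β i)
  | 0 => gammaNegOne Q a n β i
  | m + 1 => gammaAux a n β i m ⊔
      AddSubgroup.closure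
        {t | ∃ s : RLambda Q a (n + 1) (β + Pi.single i 1),
          t = K.tmul a β i (eTail Q (n + 2) β i 2 * x Q (Fin.last (n + 1)) ^ m) s} ⊔
      AddSubgroup.closure
        {t | ∃ s : RLambda Q a (n + 1) (β + Pi.single i 1),
          t = K.tmul a β i (eTail Q (n + 2) β i 2 * tau Q n (by omega) *
            x Q (Fin.last (n + 1)) ^ (m + 1)) s}

variable (Q) in
/-- The filtration `{Γ_m}_{m ∈ ℤ}` of `K`. -/
def gamma (a : I → Polynomial k) (n : ℕ) (β : I → ℕ) (i : I) (m : ℤ) : AddSubgroup (K Q a n β i) :=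
  if m < -1 then ⊥ else gammaAux Q a n β i (m + 1).toNat

variable (Q) in
/-- The product `τ_1 τ_2 ⋯ τ_{n+1}` in `R(n + 2)`. -/
def tauUp (n : ℕ) : Alg Q (n + 2) :=
  (List.ofFn fun l : Fin (n + 1) => tau Q (l : ℕ) (by omega : (l : ℕ) + 1 < n + 2)).prod

variable (Q) in
/-- The product `τ_{n+1} ⋯ τ_2 τ_1` in `R(n + 2)`. -/
def tauDown (n : ℕ) : Alg Q (n + 2) :=
  (List.ofFn fun l : Fin (n + 1) => tau Q (l : ℕ) (by omega : (l : ℕ) + 1 < n + 2)).reverse.prod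

end Algebra

end

end KLR

/-! Write θ_m = τ_m⋯τ_1 a(x_1) τ_1⋯τ_m (`theta`), so that the right-hand side of the congruence is
built from θ_{n+1}. On a sequence ν whose entry m+1 is i, θ_m behaves like a polynomial in x_{m+1}
with a computable leading term. Let p be the number of entries i among ν_1, …, ν_m, and let M be
⟨h_i, Λ⟩ plus the sum of -a_{i,ν_l} over the l ≤ m with ν_l ≠ i. Then `hasLeadingTerm` says θ_m
x_{m+1}^{2p} e(ν) = (C x_{m+1}^M + y) e(ν), where C is a product of signs and of coefficients
t_{i,j}. The error y lies in `lowerPart`: it has smaller degree in x_{m+1}, or factors through τ_m,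
or lies in the left ideal generated by a(x_1) multiplied on the right by elements of the first m
strands.

The proof is by induction on m, conjugating by τ_{m+1}. If ν_{m+1} = j ≠ i, then τ x^M τ = x^M
Q_{ji}, whose top term raises the degree by -a_{ij} and multiplies C by a unit; `cross_ne` shows
that errors remain errors. If ν_{m+1} = i, conjugation lowers the degree by two, which is why two
more powers of x are supplied; τ² = 0 gives τ x^{M+2} τ = -τ(x'^{M+1} + ⋯), with x' the variable of
the next strand, and C changes sign (`cross_self`, `theta_succ_self`). Expanding τ x'^{M+1} then
closes the induction.

The proposition is the last same-colour step, from θ_n to θ_{n+1}, stopped before this final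
expansion: `theta_succ_self` exhibits -C τ_{n+1} x_{n+2}^{M+1} modulo `gammaPart`, and M = λ_i + 2p.
The constant C depends only on β, so one c = (-C)^{-1} serves all sequences. It remains to map
`gammaPart` into Γ_{M-1} inside K (`tmul_mem_gammaAux`): elements of the first n+1 strands cross the
tensor sign, and a(x_1) dies in R^Λ. That Q_{ij} has the required leading terms follows from the
vanishing of **k** in negative degrees (`QMatrix.leadingData`). -/

namespace KLR

noncomputable section

/-! ### Local generators with indices in ℕ, and the defining relations in terms of them. -/

section LocalGenerators

variable {I k : Type*} [Fintype I] [DecidableEq I] [CommRing k]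

variable (Q : I → I → MvPolynomial (Fin 2) k) (N : ℕ)

/-- The element `x_{l+1}` of `R(N)`, and `0` if there is none. -/
def X (l : ℕ) : Alg Q N := if h : l < N then x Q ⟨l, h⟩ else 0

/-- The element `τ_{l+1}` of `R(N)`, and `0` if there is none. -/
def T (l : ℕ) : Alg Q N := if h : l + 1 < N then tau Q l h else 0

/-- The sum of the idempotents `e(ν)` such that `ν` satisfies `p`. -/
def idem (p : (Fin N → I) → Prop) [DecidablePred p] : Alg Q N := ∑ ν : Fin N → I with p ν, e Q ν

/-- The sum of the idempotents `e(ν)` such that the strand at position `l` has colour `j`. -/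
def F (l : ℕ) (j : I) : Alg Q N := idem Q N fun ν => ∀ h : l < N, ν ⟨l, h⟩ = j

/-- The sum of the idempotents `e(ν)` such that the strands at the positions `l` and `l + 1` have
the same colour. -/
def Dl (l : ℕ) : Alg Q N :=
  idem Q N fun ν => ∀ h : l + 1 < N, ν ⟨l, by omega⟩ = ν ⟨l + 1, h⟩

variable {Q N}

theorem sum_e : ∑ ν : Fin N → I, e Q ν = 1 := by
  have := mk_rel (Rel.sum_e (Q := Q) (n := N))
  simpa only [map_sum, map_one, mk_fe] using this

/-- Since the e(ν) sum to 1, identities may be checked one sequence at a time, where the defining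
relations apply directly. -/
theorem ext_e {a b : Alg Q N} (h : ∀ ν, a * e Q ν = b * e Q ν) : a = b := by
  rw [← mul_one a, ← mul_one b, ← sum_e, Finset.mul_sum, Finset.mul_sum]
  exact Finset.sum_congr rfl fun ν _ => h ν

theorem idem_mul_e (p : (Fin N → I) → Prop) [DecidablePred p] (ν : Fin N → I) :
    idem Q N p * e Q ν = if p ν then e Q ν else 0 := by
  simp [idem, Finset.sum_mul, e_mul_e, Finset.sum_ite_eq']

theorem e_mul_idem (p : (Fin N → I) → Prop) [DecidablePred p] (ν : Fin N → I) :
    e Q ν * idem Q N p = if p ν then e Q ν else 0 := by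
  simp [idem, Finset.mul_sum, e_mul_e, Finset.sum_ite_eq]

theorem idem_mul_idem (p q : (Fin N → I) → Prop) [DecidablePred p] [DecidablePred q] :
    idem Q N p * idem Q N q = idem Q N fun ν => p ν ∧ q ν := by
  refine ext_e fun ν => ?_
  rw [mul_assoc, idem_mul_e, idem_mul_e]
  by_cases hp : p ν <;> by_cases hq : q ν <;> simp [idem_mul_e, hp, hq]

theorem idem_congr {p q : (Fin N → I) → Prop} [DecidablePred p] [DecidablePred q]
    (h : ∀ ν, p ν ↔ q ν) : idem Q N p = idem Q N q := by
  simp only [idem]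
  congr 1
  ext ν
  simp [h]

theorem idem_comm (p q : (Fin N → I) → Prop) [DecidablePred p] [DecidablePred q] :
    Commute (idem Q N p) (idem Q N q) := by
  rw [Commute, SemiconjBy, idem_mul_idem, idem_mul_idem]
  exact idem_congr fun ν => and_comm

theorem idem_false {p : (Fin N → I) → Prop} [DecidablePred p] (h : ∀ ν, ¬ p ν) :
    idem Q N p = 0 := by
  simp [idem, h]

theorem X_mul_e (l : ℕ) (ν : Fin N → I) : X Q N l * e Q ν = e Q ν * X Q N l := by
  unfold X
  split_ifs with h
  · simpa only [map_mul, mk_fx, mk_fe] using mk_rel (Rel.x_mul_e (Q := Q) ⟨l, h⟩ ν)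
  · simp

theorem X_comm_idem (l : ℕ) (p : (Fin N → I) → Prop) [DecidablePred p] :
    Commute (X Q N l) (idem Q N p) := by
  refine Commute.sum_right _ _ _ fun ν _ => X_mul_e l ν

theorem X_comm (l m : ℕ) : Commute (X Q N l) (X Q N m) := by
  unfold X
  split_ifs with h h'
  · have := mk_rel (Rel.x_mul_x (Q := Q) ⟨l, h⟩ ⟨m, h'⟩)
    rwa [map_mul, map_mul] at this
  all_goals simp

theorem T_eq {l : ℕ} (h : l + 1 < N) : T Q N l = tau Q l h := by simp [T, h]

theorem X_eq {l : ℕ} (h : l < N) : X Q N l = x Q ⟨l, h⟩ := by simp [X, h]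

theorem tau_mul_e {l : ℕ} (h : l + 1 < N) (ν : Fin N → I) :
    T Q N l * e Q ν = e Q (ν ∘ sPerm l h) * T Q N l := by
  rw [T_eq h]
  simpa only [map_mul, mk_ft, mk_fe] using mk_rel (Rel.tau_mul_e (Q := Q) l h ν)

/-- Common source of all rules for moving colour idempotents past a crossing. The hypothesis is only
needed in range, because `T` vanishes elsewhere. -/
theorem T_mul_idem {l : ℕ} {p q : (Fin N → I) → Prop} [DecidablePred p] [DecidablePred q]
    (hpq : ∀ (h : l + 1 < N) ν, p ν ↔ q (ν ∘ sPerm l h)) :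
    T Q N l * idem Q N p = idem Q N q * T Q N l := by
  by_cases h : l + 1 < N
  swap; · simp [T, h]
  refine ext_e fun ν => ?_
  rw [mul_assoc, idem_mul_e, mul_assoc, tau_mul_e h, ← mul_assoc, idem_mul_e]
  by_cases hp : p ν
  · simp only [hp, (hpq h ν).1 hp, if_true, tau_mul_e h]
  · have : ¬ q (ν ∘ sPerm l h) := fun hq => hp ((hpq h ν).2 hq)
    simp [hp, this]

theorem sPerm_val {l : ℕ} (h : l + 1 < N) (m : Fin N) :
    ((sPerm l h m : Fin N) : ℕ) = Equiv.swap l (l + 1) (m : ℕ) := by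
  simp only [sPerm, Equiv.swap_apply_def, Fin.ext_iff]
  split_ifs <;> simp_all

theorem sPerm_mk_of_ne {l m : ℕ} (h : l + 1 < N) (hm : m < N) (h1 : m ≠ l) (h2 : m ≠ l + 1) :
    sPerm l h ⟨m, hm⟩ = ⟨m, hm⟩ := by
  apply Equiv.swap_apply_of_ne_of_ne <;> simpa [Fin.ext_iff]

theorem sPerm_mk_left {l : ℕ} (h : l + 1 < N) (hl : l < N) :
    sPerm l h ⟨l, hl⟩ = ⟨l + 1, h⟩ := Equiv.swap_apply_left _ _

theorem sPerm_mk_right {l : ℕ} (h : l + 1 < N) :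
    sPerm l h ⟨l + 1, h⟩ = ⟨l, by omega⟩ := Equiv.swap_apply_right _ _

theorem T_comm_F {l m : ℕ} (h1 : m ≠ l) (h2 : m ≠ l + 1) (j : I) :
    Commute (T Q N l) (F Q N m j) :=
  T_mul_idem fun h ν => by
    refine forall_congr' fun hm => ?_
    rw [Function.comp_apply, sPerm_mk_of_ne h hm h1 h2]

theorem T_mul_F_left {l : ℕ} (j : I) : T Q N l * F Q N l j = F Q N (l + 1) j * T Q N l :=
  T_mul_idem fun h ν => by
    simp [h, (by omega : l < N), sPerm_mk_right h]

theorem T_mul_F_right {l : ℕ} (j : I) : T Q N l * F Q N (l + 1) j = F Q N l j * T Q N l :=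
  T_mul_idem fun h ν => by
    simp [h, (by omega : l < N), sPerm_mk_left h]

theorem T_comm_Dl (l : ℕ) : Commute (T Q N l) (Dl Q N l) :=
  T_mul_idem fun h ν => by
    simp [h, sPerm_mk_right h, sPerm_mk_left h, eq_comm]

theorem X_comm_F (l m : ℕ) (j : I) : Commute (X Q N l) (F Q N m j) := X_comm_idem _ _

theorem X_comm_Dl (l m : ℕ) : Commute (X Q N l) (Dl Q N m) := X_comm_idem _ _

theorem F_comm_F (l m : ℕ) (j j' : I) : Commute (F Q N l j) (F Q N m j') := idem_comm _ _

theorem Dl_mul_F {l : ℕ} (h : l + 1 < N) (j : I) :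
    Dl Q N l * F Q N (l + 1) j = F Q N l j * F Q N (l + 1) j := by
  rw [Dl, F, F, idem_mul_idem, idem_mul_idem]
  refine idem_congr fun ν => ?_
  simp only [h, (by omega : l < N), forall_true_left]
  constructor
  · rintro ⟨h1, h2⟩; exact ⟨h1.trans h2, h2⟩
  · rintro ⟨h1, h2⟩; exact ⟨h1.trans h2.symm, h2⟩

theorem F_mul_self (l : ℕ) (j : I) : F Q N l j * F Q N l j = F Q N l j := by
  rw [F, idem_mul_idem]
  exact idem_congr fun ν => and_self_iff

theorem F_mul_F_of_ne {l : ℕ} (hl : l < N) {j j' : I} (h : j ≠ j') :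
    F Q N l j * F Q N l j' = 0 := by
  rw [F, F, idem_mul_idem]
  refine idem_false fun ν => ?_
  rintro ⟨h1, h2⟩
  exact h ((h1 hl).symm.trans (h2 hl))

theorem T_comm_X {l m : ℕ} (h1 : m ≠ l) (h2 : m ≠ l + 1) :
    Commute (T Q N l) (X Q N m) := by
  by_cases h : l + 1 < N
  swap; · simp [T, h]
  by_cases hm : m < N
  swap; · simp [X, hm]
  refine ext_e fun ν => ?_
  have := mk_rel (Rel.tau_mul_x (Q := Q) l h ⟨m, hm⟩ ν)
  simp only [h1, h2, false_and, if_false, map_mul, map_sub, map_zero, mk_ft, mk_fx, mk_fe,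
    sPerm_mk_of_ne h hm h1 h2] at this
  rw [sub_mul, sub_eq_zero] at this
  rw [T_eq h, X_eq hm, this]

theorem T_mul_X_left {l : ℕ} (h : l + 1 < N) :
    T Q N l * X Q N l = X Q N (l + 1) * T Q N l - Dl Q N l := by
  refine ext_e fun ν => ?_
  have := mk_rel (Rel.tau_mul_x (Q := Q) l h ⟨l, by omega⟩ ν)
  simp only [true_and, map_mul, map_sub, mk_ft, mk_fx, mk_fe, sPerm_mk_left h,
    (Nat.succ_ne_self _).symm, false_and, if_false] at this
  rw [sub_mul, sub_eq_iff_eq_add] at this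
  rw [T_eq h, X_eq h, X_eq (by omega : l < N), this, sub_mul, Dl, idem_mul_e]
  simp only [h, forall_true_left]
  split_ifs <;> simp [mk_fe, sub_eq_neg_add]

theorem T_mul_X_right {l : ℕ} (h : l + 1 < N) :
    T Q N l * X Q N (l + 1) = X Q N l * T Q N l + Dl Q N l := by
  refine ext_e fun ν => ?_
  have := mk_rel (Rel.tau_mul_x (Q := Q) l h ⟨l + 1, h⟩ ν)
  simp only [true_and, map_mul, map_sub, mk_ft, mk_fx, mk_fe, sPerm_mk_right h,
    Nat.succ_ne_self, false_and, if_false] at this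
  rw [sub_mul, sub_eq_iff_eq_add] at this
  rw [T_eq h, X_eq h, X_eq (by omega : l < N), this, add_mul, Dl, idem_mul_e]
  simp only [h, forall_true_left]
  split_ifs <;> simp [mk_fe, add_comm]

theorem T_comm_T_aux {l m : ℕ} (h : l + 1 < m) : Commute (T Q N l) (T Q N m) := by
  by_cases hm : m + 1 < N
  swap; · simp [T, hm]
  have hl : l + 1 < N := by omega
  have := mk_rel (Rel.tau_mul_tau (Q := Q) l m hl hm h)
  rw [T_eq hl, T_eq hm]
  rwa [map_mul, map_mul] at this

theorem T_comm_T {l m : ℕ} (h : l + 1 < m ∨ m + 1 < l) : Commute (T Q N l) (T Q N m) :=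
  h.elim T_comm_T_aux fun h => (T_comm_T_aux h).symm

theorem T_mul_T {l : ℕ} (h : l + 1 < N) (j j' : I) :
    T Q N l * T Q N l * (F Q N l j * F Q N (l + 1) j') =
      evalPair (Q j j') (X Q N l) (X Q N (l + 1)) * (F Q N l j * F Q N (l + 1) j') := by
  refine ext_e fun ν => ?_
  rw [F, F, idem_mul_idem, mul_assoc, idem_mul_e, mul_assoc (evalPair _ _ _), idem_mul_e]
  split_ifs with hν
  · obtain ⟨h1, h2⟩ := hν
    have := mk_rel (Rel.tau_sq (Q := Q) l h ν)
    simp only [map_mul, map_evalPair, mk_ft, mk_fx, mk_fe, h1, h2] at this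
    rw [T_eq h, X_eq h, X_eq (by omega : l < N), this]
  · simp

/-- The factor `F Q N l i` records the condition that the outer strands have equal colours. The case
j = i is allowed and is used later: there Q_{ii} = 0 kills the correction. -/
theorem braid_of_ne {l : ℕ} (h : l + 2 < N) (j i : I) :
    T Q N (l + 1) * T Q N l * T Q N (l + 1) * (F Q N (l + 1) j * F Q N (l + 2) i) =
      (T Q N l * T Q N (l + 1) * T Q N l +
        divDiff (Q i j) (X Q N l) (X Q N (l + 2)) (X Q N (l + 1)) * F Q N l i) *
          (F Q N (l + 1) j * F Q N (l + 2) i) := by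
  refine ext_e fun ν => ?_
  rw [F, F, F, idem_mul_idem, mul_assoc, idem_mul_e, mul_assoc (_ + _), idem_mul_e]
  split_ifs with hν
  · obtain ⟨h1, h2⟩ := hν
    have := mk_rel (Rel.braid (Q := Q) l h ν)
    simp only [map_mul, map_sub, mk_ft, mk_fe, h1, h2] at this
    rw [sub_mul, sub_eq_iff_eq_add] at this
    rw [T_eq h, T_eq (by omega : l + 1 < N), this, add_mul, mul_assoc (divDiff _ _ _ _), idem_mul_e,
      add_comm]
    simp only [(by omega : l < N), forall_true_left]
    split_ifs with h3
    · simp only [map_mul, map_divDiff, mk_fx, mk_fe, h3]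
      rw [X_eq h, X_eq (by omega : l < N), X_eq (by omega : l + 1 < N)]
    · simp
  · simp

end LocalGenerators

/-! ### The error terms, and conjugation of powers of x by a crossing. -/

section Filtration

variable {I k : Type*} [Fintype I] [DecidableEq I] [CommRing k]

variable (Q : I → I → MvPolynomial (Fin 2) k) (N : ℕ)

/-- The subalgebra of `R(N)` generated by the `x_l`, the `τ_l` and the local idempotents which only
involve the first `m` positions. -/
def S (m : ℕ) : Subalgebra k (Alg Q N) :=
  Algebra.adjoin k ({z | ∃ l < m, z = X Q N l} ∪ {z | ∃ l < m, ∃ j, z = F Q N l j} ∪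
    {z | ∃ l, l + 1 < m ∧ z = T Q N l})

/-- The polynomials in `x_{m+1}` of degree less than `d` with coefficients in `S m`. -/
def polyPart (m d : ℕ) : AddSubgroup (Alg Q N) :=
  AddSubgroup.closure {z | ∃ a < d, ∃ r ∈ S Q N m, z = X Q N m ^ a * r}

/-- The span of `S m * τ_m * S m`. -/
def crossPart (m : ℕ) : AddSubgroup (Alg Q N) :=
  AddSubgroup.closure {z | ∃ l, m = l + 1 ∧ ∃ r ∈ S Q N m, ∃ s ∈ S Q N m, z = r * T Q N l * s}

/-- The element `∑_ν a_{ν_1}(x_1) e(ν)`. -/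
def cycGen (a : I → Polynomial k) : Alg Q N :=
  ∑ j, Polynomial.aeval (X Q N 0) (a j) * F Q N 0 j

/-- The span of `R(N) a(x_1) S m`. -/
def cycPart (a : I → Polynomial k) (m : ℕ) : AddSubgroup (Alg Q N) :=
  AddSubgroup.closure {z | 0 < m ∧ ∃ w, ∃ s ∈ S Q N m, z = w * cycGen Q N a * s}

/-- Elements of `x_{m+1}`-degree less than `d` modulo `S m * τ_m * S m` and the cyclotomic
relation. -/
def lowerPart (a : I → Polynomial k) (m d : ℕ) : AddSubgroup (Alg Q N) :=
  polyPart Q N m d ⊔ crossPart Q N m ⊔ cycPart Q N a m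

/-- The analogue of `Γ_{d-1}` in `R(N)`. -/
def gammaPart (a : I → Polynomial k) (m d : ℕ) : AddSubgroup (Alg Q N) :=
  polyPart Q N (m + 1) d ⊔
  AddSubgroup.closure {z | ∃ b ≤ d, ∃ r ∈ S Q N (m + 1), z = T Q N m * X Q N (m + 1) ^ b * r} ⊔
  AddSubgroup.closure {z | ∃ l, m = l + 1 ∧ ∃ r ∈ S Q N m, ∃ s ∈ S Q N (m + 1),
    z = r * T Q N l * T Q N m * s} ⊔
  cycPart Q N a (m + 1)

/-- The complete homogeneous polynomial of degree `b - 1` in `x_{l+1}` and `x_{l+2}`. -/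
def hsum (l b : ℕ) : Alg Q N := ∑ c ∈ Finset.range b, X Q N l ^ c * X Q N (l + 1) ^ (b - 1 - c)

/-- The element `τ_m ⋯ τ_1 a(x_1) τ_1 ⋯ τ_m`. -/
def theta (a : I → Polynomial k) : ℕ → Alg Q N
  | 0 => cycGen Q N a
  | m + 1 => T Q N m * theta a m * T Q N m

variable {Q N}

theorem X_mem_S {l m : ℕ} (h : l < m) : X Q N l ∈ S Q N m :=
  Algebra.subset_adjoin (Or.inl (Or.inl ⟨l, h, rfl⟩))

theorem F_mem_S {l m : ℕ} (h : l < m) (j : I) : F Q N l j ∈ S Q N m :=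
  Algebra.subset_adjoin (Or.inl (Or.inr ⟨l, h, j, rfl⟩))

theorem T_mem_S {l m : ℕ} (h : l + 1 < m) : T Q N l ∈ S Q N m :=
  Algebra.subset_adjoin (Or.inr ⟨l, h, rfl⟩)

theorem S_mono {m m' : ℕ} (h : m ≤ m') : S Q N m ≤ S Q N m' := by
  refine Algebra.adjoin_le ?_
  rintro z ((⟨l, hl, rfl⟩ | ⟨l, hl, j, rfl⟩) | ⟨l, hl, rfl⟩)
  exacts [X_mem_S (by omega), F_mem_S (by omega) j, T_mem_S (by omega)]

theorem S_comm {m : ℕ} {z r : Alg Q N} (hr : r ∈ S Q N m) (hX : ∀ l < m, Commute (X Q N l) z)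
    (hF : ∀ l < m, ∀ j, Commute (F Q N l j) z) (hT : ∀ l, l + 1 < m → Commute (T Q N l) z) :
    Commute r z := by
  have : S Q N m ≤ Subalgebra.centralizer k {z} := by
    refine Algebra.adjoin_le ?_
    rintro y ((⟨l, hl, rfl⟩ | ⟨l, hl, j, rfl⟩) | ⟨l, hl, rfl⟩) _ rfl
    exacts [(hX l hl).symm, (hF l hl j).symm, (hT l hl).symm]
  exact ((this hr) z rfl).symm

theorem S_comm_X {l m : ℕ} {r : Alg Q N} (hr : r ∈ S Q N m) (h : m ≤ l) : Commute r (X Q N l) :=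
  S_comm hr (fun _ _ => X_comm _ _) (fun _ _ _ => (X_comm_F _ _ _).symm)
    fun _ _ => T_comm_X (by omega) (by omega)

theorem S_comm_F {l m : ℕ} {r : Alg Q N} (hr : r ∈ S Q N m) (h : m ≤ l) (j : I) :
    Commute r (F Q N l j) :=
  S_comm hr (fun _ _ => X_comm_F _ _ _) (fun _ _ _ => F_comm_F _ _ _ _)
    fun _ _ => T_comm_F (by omega) (by omega) _

theorem S_comm_T {l m : ℕ} {r : Alg Q N} (hr : r ∈ S Q N m) (h : m ≤ l) : Commute r (T Q N l) :=
  S_comm hr (fun _ _ => (T_comm_X (by omega) (by omega)).symm)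
    (fun _ _ _ => (T_comm_F (by omega) (by omega) _).symm) fun _ _ => T_comm_T (by omega)

theorem aeval_X_mem_S {l m : ℕ} (h : l < m) (f : Polynomial k) :
    Polynomial.aeval (X Q N l) f ∈ S Q N m :=
  Algebra.adjoin_le (by rintro _ rfl; exact X_mem_S h) (Polynomial.aeval_mem_adjoin_singleton k _)

theorem cycGen_mem_S (a : I → Polynomial k) {m : ℕ} (h : 0 < m) : cycGen Q N a ∈ S Q N m :=
  sum_mem fun j _ => mul_mem (aeval_X_mem_S h _) (F_mem_S h j)

/-- What stands to the right of a(x_1) only involves the first m+1 strands, so left multiples of θ_m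
lie in `cycPart` at level m+1. -/
theorem theta_eq (a : I → Polynomial k) (m : ℕ) :
    ∃ w, ∃ s ∈ S Q N (m + 1), theta Q N a m = w * cycGen Q N a * s := by
  induction m with
  | zero => exact ⟨1, 1, one_mem _, by simp [theta]⟩
  | succ m ih =>
    obtain ⟨w, s, hs, h⟩ := ih
    refine ⟨T Q N m * w, s * T Q N m, mul_mem (S_mono (by omega) hs) (T_mem_S (by omega)), ?_⟩
    simp only [theta, h, mul_assoc]

theorem hsum_succ_left (l b : ℕ) :
    hsum Q N l (b + 1) = hsum Q N l b * X Q N l + X Q N (l + 1) ^ b := by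
  rw [hsum, Finset.sum_range_succ', hsum, Finset.sum_mul]
  congr 1
  · refine Finset.sum_congr rfl fun c hc => ?_
    rw [mul_assoc, ((X_comm (l + 1) l).pow_left _).eq, ← mul_assoc, ← pow_succ,
      (by omega : b + 1 - 1 - (c + 1) = b - 1 - c)]
  · simp

theorem hsum_succ_right (l b : ℕ) :
    hsum Q N l (b + 1) = hsum Q N l b * X Q N (l + 1) + X Q N l ^ b := by
  rw [hsum, Finset.sum_range_succ, hsum, Finset.sum_mul]
  congr 1
  · refine Finset.sum_congr rfl fun c hc => ?_
    have := Finset.mem_range.1 hc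
    rw [mul_assoc, ← pow_succ, (by omega : b - 1 - c + 1 = b + 1 - 1 - c)]
  · simp

/-- Each passage of one x contributes the idempotent `Dl`; the accumulated powers form the divided
difference of x^b, which is `hsum`. -/
theorem T_mul_X_left_pow {l : ℕ} (h : l + 1 < N) (b : ℕ) :
    T Q N l * X Q N l ^ b = X Q N (l + 1) ^ b * T Q N l - hsum Q N l b * Dl Q N l := by
  induction b with
  | zero => simp [hsum]
  | succ b ih =>
    rw [pow_succ, ← mul_assoc, ih, sub_mul, mul_assoc, T_mul_X_left h, mul_sub, ← mul_assoc,
      ← pow_succ, mul_assoc (hsum Q N l b), ← (X_comm_Dl l l).eq, ← mul_assoc, sub_sub,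
      hsum_succ_left, add_mul, add_comm (X Q N (l + 1) ^ b * _)]

theorem T_mul_X_right_pow {l : ℕ} (h : l + 1 < N) (b : ℕ) :
    T Q N l * X Q N (l + 1) ^ b = X Q N l ^ b * T Q N l + hsum Q N l b * Dl Q N l := by
  induction b with
  | zero => simp [hsum]
  | succ b ih =>
    rw [pow_succ, ← mul_assoc, ih, add_mul, mul_assoc, T_mul_X_right h, mul_add, ← mul_assoc,
      ← pow_succ, mul_assoc (hsum Q N l b), ← (X_comm_Dl (l + 1) l).eq, ← mul_assoc, add_assoc,
      hsum_succ_right, add_mul, add_comm (X Q N l ^ b * _)]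

/-- The idempotent for the colours `j` at position `l` and `j'` at position `l + 1`. -/
def FF (Q : I → I → MvPolynomial (Fin 2) k) (N l : ℕ) (j j' : I) : Alg Q N :=
  F Q N l j * F Q N (l + 1) j'

theorem T_mul_FF (l : ℕ) (j j' : I) : T Q N l * FF Q N l j j' = FF Q N l j' j * T Q N l := by
  rw [FF, ← mul_assoc, T_mul_F_left, mul_assoc, T_mul_F_right, ← mul_assoc,
    (F_comm_F (l + 1) l j j').eq, FF]

theorem X_comm_FF (l m : ℕ) (j j' : I) : Commute (X Q N l) (FF Q N m j j') :=
  (X_comm_F _ _ _).mul_right (X_comm_F _ _ _)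

theorem S_comm_FF {l m : ℕ} {r : Alg Q N} (hr : r ∈ S Q N m) (h : m ≤ l) (j j' : I) :
    Commute r (FF Q N l j j') :=
  (S_comm_F hr h j).mul_right (S_comm_F hr (by omega) j')

theorem Dl_mul_FF_of_ne {l : ℕ} (h : l + 1 < N) {i j : I} (hij : j ≠ i) :
    Dl Q N l * FF Q N l j i = 0 := by
  rw [FF, (F_comm_F l (l + 1) j i).eq, ← mul_assoc, Dl_mul_F h, (F_comm_F l (l + 1) i i).eq,
    mul_assoc, F_mul_F_of_ne (by omega) hij.symm, mul_zero]

theorem Dl_mul_FF_self {l : ℕ} (h : l + 1 < N) (i : I) :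
    Dl Q N l * FF Q N l i i = FF Q N l i i := by
  rw [FF, (F_comm_F l (l + 1) i i).eq, ← mul_assoc, Dl_mul_F h, (F_comm_F l (l + 1) i i).eq,
    mul_assoc, F_mul_self]

theorem evalPair_zero {A : Type*} [Ring A] [Algebra k A] (u v : A) :
    evalPair (0 : MvPolynomial (Fin 2) k) u v = 0 := by simp [evalPair]

theorem divDiff_zero {A : Type*} [Ring A] [Algebra k A] (u w v : A) :
    divDiff (0 : MvPolynomial (Fin 2) k) u w v = 0 := by simp [divDiff]

theorem T_mul_T_FF_self {l : ℕ} (h : l + 1 < N) {i : I} (hi : Q i i = 0) :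
    T Q N l * T Q N l * FF Q N l i i = 0 := by
  rw [FF, T_mul_T h, hi, evalPair_zero, zero_mul]

/-- For distinct colours x slides through the crossing without correction, and τ² = Q_{ji} remains.
-/
theorem T_mul_X_pow_mul_T_of_ne {l : ℕ} (h : l + 1 < N) {i j : I} (hij : j ≠ i) (b : ℕ) :
    T Q N l * X Q N l ^ b * T Q N l * FF Q N l j i =
      X Q N (l + 1) ^ b * evalPair (Q j i) (X Q N l) (X Q N (l + 1)) * FF Q N l j i := by
  rw [T_mul_X_left_pow h, sub_mul, sub_mul, mul_assoc (hsum Q N l b), ← (T_comm_Dl l).eq,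
    mul_assoc (hsum Q N l b), mul_assoc (T Q N l), Dl_mul_FF_of_ne h hij, mul_zero, mul_zero,
    sub_zero, mul_assoc, mul_assoc, ← mul_assoc (T Q N l), FF, T_mul_T h, ← mul_assoc]

/-- Slide the power through the right-hand crossing: the main term contains τ² = 0, and only the
divided difference survives. -/
theorem T_mul_X_pow_mul_T_self {l : ℕ} (h : l + 1 < N) {i : I} (hi : Q i i = 0) (b : ℕ) :
    T Q N l * X Q N l ^ b * T Q N l * FF Q N l i i =
      -(T Q N l * hsum Q N l b * FF Q N l i i) := by
  have := T_mul_X_right_pow (Q := Q) h b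
  rw [mul_assoc (T Q N l), eq_sub_of_add_eq this.symm, mul_sub, sub_mul, ← mul_assoc, mul_assoc,
    ((X_comm_FF (l + 1) l i i).pow_left b).eq, ← mul_assoc, T_mul_T_FF_self h hi, zero_mul,
    zero_sub, mul_assoc, mul_assoc, Dl_mul_FF_self h, mul_assoc]

end Filtration

/-! ### Stability of the error terms under conjugation by a crossing. -/

section Steps

variable {I k : Type*} [Fintype I] [DecidableEq I] [CommRing k]
variable {Q : I → I → MvPolynomial (Fin 2) k} {N : ℕ}

/-- The additive subgroup `L * G`. -/
abbrev timesR (L : AddSubgroup (Alg Q N)) (G : Alg Q N) : AddSubgroup (Alg Q N) :=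
  L.map (AddMonoidHom.mulRight G)

theorem mul_mem_timesR {L : AddSubgroup (Alg Q N)} (G : Alg Q N) {y : Alg Q N} (h : y ∈ L) :
    y * G ∈ timesR L G := ⟨y, h, rfl⟩

theorem polyPart_le (a : I → Polynomial k) (m d : ℕ) : polyPart Q N m d ≤ lowerPart Q N a m d :=
  le_sup_left.trans le_sup_left

theorem crossPart_le (a : I → Polynomial k) (m d : ℕ) : crossPart Q N m ≤ lowerPart Q N a m d :=
  le_sup_right.trans le_sup_left

theorem cycPart_le (a : I → Polynomial k) (m d : ℕ) : cycPart Q N a m ≤ lowerPart Q N a m d :=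
  le_sup_right

theorem mem_polyPart {m d b : ℕ} (h : b < d) {r : Alg Q N} (hr : r ∈ S Q N m) :
    X Q N m ^ b * r ∈ polyPart Q N m d := AddSubgroup.subset_closure ⟨b, h, r, hr, rfl⟩

theorem mem_crossPart {l : ℕ} {r s : Alg Q N} (hr : r ∈ S Q N (l + 1)) (hs : s ∈ S Q N (l + 1)) :
    r * T Q N l * s ∈ crossPart Q N (l + 1) :=
  AddSubgroup.subset_closure ⟨l, rfl, r, hr, s, hs, rfl⟩

theorem mem_cycPart (a : I → Polynomial k) {m : ℕ} (hm : 0 < m) (w : Alg Q N) {s : Alg Q N}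
    (hs : s ∈ S Q N m) : w * cycGen Q N a * s ∈ cycPart Q N a m :=
  AddSubgroup.subset_closure ⟨hm, w, s, hs, rfl⟩

theorem polyPart_mono {m d d' : ℕ} (h : d ≤ d') : polyPart Q N m d ≤ polyPart Q N m d' := by
  refine AddSubgroup.closure_mono ?_
  rintro z ⟨b, hb, r, hr, rfl⟩
  exact ⟨b, by omega, r, hr, rfl⟩

theorem polyPart_mul {m d : ℕ} {y s : Alg Q N} (hy : y ∈ polyPart Q N m d) (hs : s ∈ S Q N m) :
    y * s ∈ polyPart Q N m d := by
  have : polyPart Q N m d ≤ (polyPart Q N m d).comap (AddMonoidHom.mulRight s) := by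
    refine (AddSubgroup.closure_le _).2 ?_
    rintro z ⟨b, hb, r, hr, rfl⟩
    show X Q N m ^ b * r * s ∈ polyPart Q N m d
    rw [mul_assoc]
    exact mem_polyPart hb (mul_mem hr hs)
  exact this hy

theorem lowerPart_le_of {a : I → Polynomial k} {m d : ℕ} {L : AddSubgroup (Alg Q N)}
    (f : Alg Q N →+ Alg Q N)
    (h1 : ∀ b < d, ∀ r ∈ S Q N m, f (X Q N m ^ b * r) ∈ L)
    (h2 : ∀ l, m = l + 1 → ∀ r ∈ S Q N m, ∀ s ∈ S Q N m, f (r * T Q N l * s) ∈ L)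
    (h3 : 0 < m → ∀ w, ∀ s ∈ S Q N m, f (w * cycGen Q N a * s) ∈ L)
    {y : Alg Q N} (hy : y ∈ lowerPart Q N a m d) : f y ∈ L := by
  have : lowerPart Q N a m d ≤ L.comap f := by
    refine sup_le (sup_le ?_ ?_) ?_ <;> refine (AddSubgroup.closure_le _).2 ?_
    · rintro z ⟨b, hb, r, hr, rfl⟩
      exact h1 b hb r hr
    · rintro z ⟨l, hl, r, hr, s, hs, rfl⟩
      exact h2 l hl r hr s hs
    · rintro z ⟨hm, w, s, hs, rfl⟩
      exact h3 hm w s hs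
  exact this hy

/-- Multiplying a power of `x_{m+2}` by a polynomial in `x_{m+1}`, `x_{m+2}` whose exponents of
`x_{m+2}` are bounded. -/
theorem pow_mul_evalPair_mem {m b d' : ℕ} {q : MvPolynomial (Fin 2) k}
    (hq : ∀ u ∈ q.support, b + u 1 < d') :
    X Q N (m + 1) ^ b * evalPair q (X Q N m) (X Q N (m + 1)) ∈ polyPart Q N (m + 1) d' := by
  rw [evalPair, Finset.mul_sum]
  refine sum_mem fun u hu => ?_
  rw [mul_smul_comm, ((X_comm m (m + 1)).pow_pow _ _).eq, ← mul_assoc, ← pow_add,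
    ← mul_smul_comm]
  exact mem_polyPart (hq u hu) (Subalgebra.smul_mem _ (pow_mem (X_mem_S (by omega)) _) _)

/-- Isolates the top term: every monomial of q other than v^d has exponent of v below d. If v^d does
not occur, the subtracted coefficient is zero. -/
theorem pow_mul_evalPair_sub_mem {m b d : ℕ} {q : MvPolynomial (Fin 2) k}
    (hq : ∀ u ∈ q.support, u 1 < d ∨ u = Finsupp.single 1 d) :
    X Q N (m + 1) ^ b * evalPair q (X Q N m) (X Q N (m + 1)) -
      q.coeff (Finsupp.single 1 d) • X Q N (m + 1) ^ (b + d) ∈ polyPart Q N (m + 1) (b + d) := by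
  have key : ∀ u ∈ q.support \ {Finsupp.single 1 d},
      X Q N (m + 1) ^ b * (q.coeff u • (X Q N m ^ u 0 * X Q N (m + 1) ^ u 1)) ∈
        polyPart Q N (m + 1) (b + d) := by
    intro u hu
    rw [Finset.mem_sdiff, Finset.mem_singleton] at hu
    have := (hq u hu.1).resolve_right hu.2
    rw [mul_smul_comm, ((X_comm m (m + 1)).pow_pow _ _).eq, ← mul_assoc, ← pow_add,
      ← mul_smul_comm]
    exact mem_polyPart (by omega) (Subalgebra.smul_mem _ (pow_mem (X_mem_S (by omega)) _) _)
  have := sum_mem key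
  rw [← Finset.mul_sum] at this
  convert this using 1
  rw [evalPair]
  by_cases h : Finsupp.single 1 d ∈ q.support
  · rw [← Finset.sum_sdiff (Finset.singleton_subset_iff.2 h), mul_add, Finset.sum_singleton,
      add_sub_assoc, add_eq_left, sub_eq_zero, mul_smul_comm, pow_add]
    simp
  · rw [Finset.sdiff_singleton_eq_erase, Finset.erase_eq_of_notMem h,
      MvPolynomial.notMem_support_iff.1 h, zero_smul, sub_zero]

/-- The divided difference of u^p only contains powers of the new variable with exponent at most p -
1, hence the strict bound. -/
theorem divDiff_mem {l d : ℕ} {q : MvPolynomial (Fin 2) k} (hq : ∀ u ∈ q.support, u 0 ≤ d) :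
    divDiff q (X Q N l) (X Q N (l + 2)) (X Q N (l + 1)) ∈ polyPart Q N (l + 2) d := by
  rw [divDiff]
  refine sum_mem fun u hu => ?_
  rw [Finset.sum_mul, Finset.smul_sum]
  refine sum_mem fun b hb => ?_
  have := hq u hu
  have := Finset.mem_range.1 hb
  rw [((X_comm l (l + 2)).pow_pow _ _).eq, mul_assoc, ← mul_smul_comm]
  exact mem_polyPart (by omega) (Subalgebra.smul_mem _
    (mul_mem (pow_mem (X_mem_S (by omega)) _) (pow_mem (X_mem_S (by omega)) _)) _)

/-- Conjugating by the crossing with a strand of a different colour. -/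
theorem cross_ne {a : I → Polynomial k} {m : ℕ} (hm : m + 1 < N) {i j : I} (hij : j ≠ i)
    {d dij : ℕ} (h1 : ∀ u ∈ (Q j i).support, u 1 < dij ∨ u = Finsupp.single 1 dij)
    (h2 : ∀ u ∈ (Q i j).support, u 0 ≤ dij) {y : Alg Q N} (hy : y ∈ lowerPart Q N a m d) :
    T Q N m * y * T Q N m * FF Q N m j i ∈
      timesR (lowerPart Q N a (m + 1) (d + dij)) (FF Q N m j i) := by
  have h1' : ∀ u ∈ (Q j i).support, u 1 ≤ dij := fun u hu => by
    rcases h1 u hu with h | rfl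
    · exact h.le
    · simp
  refine lowerPart_le_of (a := a) (m := m) (d := d) ((AddMonoidHom.mulRight (FF Q N m j i)).comp
    ((AddMonoidHom.mulRight (T Q N m)).comp (AddMonoidHom.mulLeft (T Q N m)))) ?_ ?_ ?_ hy
  -- Polynomial terms: the coefficient r commutes with the crossing, and x^b is multiplied by
  -- Q_{ji}, of degree at most `dij` in the new variable.
  · intro b hb r hr
    show T Q N m * (X Q N m ^ b * r) * T Q N m * FF Q N m j i ∈ _
    have : T Q N m * (X Q N m ^ b * r) * T Q N m * FF Q N m j i =
        X Q N (m + 1) ^ b * evalPair (Q j i) (X Q N m) (X Q N (m + 1)) * r * FF Q N m j i := by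
      rw [← mul_assoc, mul_assoc _ r, (S_comm_T hr le_rfl).eq, ← mul_assoc, mul_assoc _ r,
        (S_comm_FF hr le_rfl j i).eq, ← mul_assoc, T_mul_X_pow_mul_T_of_ne hm hij, mul_assoc _ _ r,
        ← (S_comm_FF hr le_rfl j i).eq, ← mul_assoc]
    rw [this]
    refine mul_mem_timesR _ (polyPart_le _ _ _ (polyPart_mul ?_ (S_mono (by omega) hr)))
    exact pow_mul_evalPair_mem fun u hu => by have := h1' u hu; omega
  -- Crossing terms: r and s commute with the outer crossing, so the braid relation applies in the
  -- middle. Its main term is again a crossing term, and its correction is polynomial of degree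
  -- below `dij`.
  · rintro l rfl r hr s hs
    show T Q N (l + 1) * (r * T Q N l * s) * T Q N (l + 1) * FF Q N (l + 1) j i ∈ _
    have : T Q N (l + 1) * (r * T Q N l * s) * T Q N (l + 1) * FF Q N (l + 1) j i =
        (r * T Q N l * T Q N (l + 1) * (T Q N l * s) + r *
          (divDiff (Q i j) (X Q N l) (X Q N (l + 2)) (X Q N (l + 1)) * F Q N l i) * s) *
            FF Q N (l + 1) j i := by
      calc _ = r * (T Q N (l + 1) * T Q N l * T Q N (l + 1) * FF Q N (l + 1) j i) * s := by
            simp only [← mul_assoc]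
            rw [← (S_comm_T hr le_rfl).eq, mul_assoc _ s, (S_comm_T hs le_rfl).eq, ← mul_assoc,
              mul_assoc _ s, (S_comm_FF hs le_rfl j i).eq, ← mul_assoc]
        _ = _ := by
            rw [FF, braid_of_ne hm, ← FF, mul_assoc, mul_assoc, ← (S_comm_FF hs le_rfl j i).eq]
            simp only [add_mul, mul_add, mul_assoc]
    rw [this]
    refine mul_mem_timesR _ (add_mem (crossPart_le _ _ _ ?_) (polyPart_le _ _ _ ?_))
    · exact mem_crossPart (mul_mem (S_mono (by omega) hr) (T_mem_S (by omega)))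
        (mul_mem (T_mem_S (by omega)) (S_mono (by omega) hs))
    · have hd : divDiff (Q i j) (X Q N l) (X Q N (l + 2)) (X Q N (l + 1)) ∈
          polyPart Q N (l + 2) dij := divDiff_mem h2
      have hc : r * divDiff (Q i j) (X Q N l) (X Q N (l + 2)) (X Q N (l + 1)) ∈
          polyPart Q N (l + 2) dij := by
        have : polyPart Q N (l + 2) dij ≤
            (polyPart Q N (l + 2) dij).comap (AddMonoidHom.mulLeft r) := by
          refine (AddSubgroup.closure_le _).2 ?_
          rintro z ⟨b, hb, t, ht, rfl⟩
          show r * (X Q N (l + 2) ^ b * t) ∈ polyPart Q N (l + 2) dij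
          rw [← mul_assoc, ((S_comm_X hr (by omega)).pow_right b).eq, mul_assoc]
          exact mem_polyPart hb (mul_mem (S_mono (by omega) hr) ht)
        exact this hd
      rw [← mul_assoc]
      exact polyPart_mono (by omega) (polyPart_mul (polyPart_mul hc (F_mem_S (by omega) i))
        (S_mono (by omega) hs))
  -- Cyclotomic terms: a(x_1) commutes with the crossing only because 0 < m, which is why `cycPart`
  -- is trivial at m = 0.
  · intro h0 w s hs
    show T Q N m * (w * cycGen Q N a * s) * T Q N m * FF Q N m j i ∈ _
    refine mul_mem_timesR _ (cycPart_le _ _ _ ?_)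
    have : T Q N m * (w * cycGen Q N a * s) * T Q N m =
        T Q N m * w * T Q N m * cycGen Q N a * s := by
      rw [← mul_assoc, mul_assoc _ s, (S_comm_T hs le_rfl).eq, ← mul_assoc, ← mul_assoc,
        mul_assoc _ (cycGen Q N a), (S_comm_T (cycGen_mem_S a h0) le_rfl).eq, ← mul_assoc]
    rw [this]
    exact mem_cycPart a (by omega) _ (S_mono (by omega) hs)

theorem mem_gammaPart_T (a : I → Polynomial k) {m d b : ℕ} (h : b ≤ d) {r : Alg Q N}
    (hr : r ∈ S Q N (m + 1)) : T Q N m * X Q N (m + 1) ^ b * r ∈ gammaPart Q N a m d := by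
  rw [gammaPart, sup_assoc, sup_assoc]
  exact AddSubgroup.mem_sup_right (AddSubgroup.mem_sup_left
    (AddSubgroup.subset_closure ⟨b, h, r, hr, rfl⟩))

theorem mem_gammaPart_TT (a : I → Polynomial k) {l d : ℕ} {r s : Alg Q N}
    (hr : r ∈ S Q N (l + 1)) (hs : s ∈ S Q N (l + 2)) :
    r * T Q N l * T Q N (l + 1) * s ∈ gammaPart Q N a (l + 1) d := by
  rw [gammaPart, sup_assoc]
  exact AddSubgroup.mem_sup_right (AddSubgroup.mem_sup_left
    (AddSubgroup.subset_closure ⟨l, rfl, r, hr, s, hs, rfl⟩))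

theorem cycPart_le_gammaPart (a : I → Polynomial k) (m d : ℕ) :
    cycPart Q N a (m + 1) ≤ gammaPart Q N a m d := le_sup_right

theorem gammaPart_le_of {a : I → Polynomial k} {m d : ℕ} {B : Type*} [AddCommGroup B]
    {L : AddSubgroup B} (f : Alg Q N →+ B)
    (h1 : ∀ b < d, ∀ r ∈ S Q N (m + 1), f (X Q N (m + 1) ^ b * r) ∈ L)
    (h2 : ∀ b ≤ d, ∀ r ∈ S Q N (m + 1), f (T Q N m * X Q N (m + 1) ^ b * r) ∈ L)
    (h3 : ∀ l, m = l + 1 → ∀ r ∈ S Q N m, ∀ s ∈ S Q N (m + 1),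
      f (r * T Q N l * T Q N m * s) ∈ L)
    (h4 : ∀ w, ∀ s ∈ S Q N (m + 1), f (w * cycGen Q N a * s) ∈ L)
    {y : Alg Q N} (hy : y ∈ gammaPart Q N a m d) : f y ∈ L := by
  have : gammaPart Q N a m d ≤ L.comap f := by
    refine sup_le (sup_le (sup_le ?_ ?_) ?_) ?_ <;> refine (AddSubgroup.closure_le _).2 ?_
    · rintro z ⟨b, hb, r, hr, rfl⟩
      exact h1 b hb r hr
    · rintro z ⟨b, hb, r, hr, rfl⟩
      exact h2 b hb r hr
    · rintro z ⟨l, hl, r, hr, s, hs, rfl⟩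
      exact h3 l hl r hr s hs
    · rintro z ⟨_, w, s, hs, rfl⟩
      exact h4 w s hs
  exact this hy

theorem T_mul_hsum_mem (a : I → Polynomial k) {m b d : ℕ} (h : b ≤ d + 1) {r : Alg Q N}
    (hr : r ∈ S Q N (m + 1)) : T Q N m * hsum Q N m b * r ∈ gammaPart Q N a m d := by
  rw [hsum, Finset.mul_sum, Finset.sum_mul]
  refine sum_mem fun c hc => ?_
  have := Finset.mem_range.1 hc
  rw [((X_comm m (m + 1)).pow_pow _ _).eq, ← mul_assoc, mul_assoc _ _ r]
  exact mem_gammaPart_T a (by omega) (mul_mem (pow_mem (X_mem_S (by omega)) _) hr)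

/-- Conjugating by the crossing with a strand of the same colour. -/
theorem cross_self {a : I → Polynomial k} {m : ℕ} (hm : m + 1 < N) {i : I} (hi : Q i i = 0)
    {d : ℕ} {y : Alg Q N} (hy : y ∈ lowerPart Q N a m d) :
    T Q N m * y * X Q N m ^ 2 * T Q N m * FF Q N m i i ∈
      timesR (gammaPart Q N a m d) (FF Q N m i i) := by
  refine lowerPart_le_of (a := a) (m := m) (d := d) ((AddMonoidHom.mulRight (FF Q N m i i)).comp
    ((AddMonoidHom.mulRight (T Q N m)).comp ((AddMonoidHom.mulRight (X Q N m ^ 2)).comp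
      (AddMonoidHom.mulLeft (T Q N m))))) ?_ ?_ ?_ hy
  -- Polynomial terms: τ x^{b+2} τ = -τ · `hsum` (b+2), with exponents of the new variable at most b
  -- + 1 ≤ d.
  · intro b hb r hr
    show T Q N m * (X Q N m ^ b * r) * X Q N m ^ 2 * T Q N m * FF Q N m i i ∈ _
    have : T Q N m * (X Q N m ^ b * r) * X Q N m ^ 2 * T Q N m * FF Q N m i i =
        -(T Q N m * hsum Q N m (b + 2) * r) * FF Q N m i i := by
      rw [← mul_assoc, mul_assoc _ r, ((S_comm_X hr le_rfl).pow_right 2).eq, ← mul_assoc,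
        mul_assoc _ r, (S_comm_T hr le_rfl).eq, ← mul_assoc, mul_assoc _ r,
        (S_comm_FF hr le_rfl i i).eq, ← mul_assoc, mul_assoc _ (X Q N m ^ b), ← pow_add,
        T_mul_X_pow_mul_T_self hm hi, neg_mul, neg_mul, mul_assoc _ _ r,
        ← (S_comm_FF hr le_rfl i i).eq, ← mul_assoc]
    rw [this]
    exact mul_mem_timesR _ (neg_mem (T_mul_hsum_mem a (by omega) (S_mono (by omega) hr)))
  · rintro l rfl r hr s hs
    show T Q N (l + 1) * (r * T Q N l * s) * X Q N (l + 1) ^ 2 * T Q N (l + 1) *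
      FF Q N (l + 1) i i ∈ _
    have hb : T Q N (l + 1) * T Q N l * T Q N (l + 1) * FF Q N (l + 1) i i =
        T Q N l * T Q N (l + 1) * T Q N l * FF Q N (l + 1) i i := by
      rw [FF, braid_of_ne hm, hi, divDiff_zero, zero_mul, add_zero]
    have hΔ : Dl Q N l * FF Q N (l + 1) i i = F Q N l i * FF Q N (l + 1) i i := by
      rw [FF, ← mul_assoc, ← mul_assoc, Dl_mul_F (by omega)]
    -- The two special cases on equal colours: τ² = 0 and τ x τ = -τ.
    have h0 := T_mul_X_pow_mul_T_self hm hi 0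
    have h1 := T_mul_X_pow_mul_T_self hm hi 1
    have hs1 : hsum Q N (l + 1) 1 = 1 := by simp [hsum]
    have hs2 : hsum Q N l 2 = X Q N l + X Q N (l + 1) := by
      rw [hsum_succ_left]
      simp [hsum]
    have hs0 : hsum Q N (l + 1) 0 = 0 := by simp [hsum]
    rw [pow_zero, mul_one, hs0, mul_zero, zero_mul, neg_zero] at h0
    rw [pow_one, hs1, mul_one] at h1
    have key1 : T Q N (l + 1) * (X Q N l ^ 2 * T Q N l) * T Q N (l + 1) * FF Q N (l + 1) i i =
        X Q N l ^ 2 * T Q N l * T Q N (l + 1) * T Q N l * FF Q N (l + 1) i i := by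
      rw [← mul_assoc, ((T_comm_X (by omega) (by omega)).pow_right 2).eq, mul_assoc, mul_assoc,
        mul_assoc, ← mul_assoc (T Q N l), ← mul_assoc (T Q N (l + 1)), ← mul_assoc (T Q N (l + 1)),
        hb]
      simp only [mul_assoc]
    -- Moving x² through the inner crossing leaves the sum of two variables. The one commuting with
    -- the outer crossing dies by τ² = 0; the other gives -τ.
    have key2 : T Q N (l + 1) * (hsum Q N l 2 * Dl Q N l) * T Q N (l + 1) * FF Q N (l + 1) i i =
        -(T Q N (l + 1) * F Q N l i * FF Q N (l + 1) i i) := by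
      have c1 : Commute (T Q N (l + 1)) (F Q N l i) := T_comm_F (by omega) (by omega) i
      have c2 : Commute (T Q N (l + 1)) (X Q N l) := T_comm_X (by omega) (by omega)
      calc _ = F Q N l i * (X Q N l * (T Q N (l + 1) * T Q N (l + 1) * FF Q N (l + 1) i i) +
            T Q N (l + 1) * X Q N (l + 1) * T Q N (l + 1) * FF Q N (l + 1) i i) := by
            rw [mul_assoc, T_mul_FF, mul_assoc, mul_assoc, ← mul_assoc (Dl Q N l), hΔ,
              mul_assoc (F _ _ _ _), ← T_mul_FF, hs2]
            simp only [mul_add, add_mul, mul_assoc, (X_comm_F l l i).left_comm,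
              (X_comm_F (l + 1) l i).left_comm, c1.left_comm, c2.left_comm]
        _ = _ := by rw [h0, h1, mul_zero, zero_add, mul_neg, ← mul_assoc, c1.eq]
    have : T Q N (l + 1) * (r * T Q N l * s) * X Q N (l + 1) ^ 2 * T Q N (l + 1) *
          FF Q N (l + 1) i i =
        (r * X Q N l ^ 2 * T Q N l * T Q N (l + 1) * (T Q N l * s) -
          T Q N (l + 1) * X Q N (l + 1 + 1) ^ 0 * (r * F Q N l i * s)) * FF Q N (l + 1) i i := by
      calc _ = r * (T Q N (l + 1) * (T Q N l * X Q N (l + 1) ^ 2) * T Q N (l + 1) *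
              FF Q N (l + 1) i i) * s := by
            simp only [← mul_assoc]
            rw [← (S_comm_T hr le_rfl).eq, mul_assoc _ s, ((S_comm_X hs le_rfl).pow_right 2).eq,
              ← mul_assoc, mul_assoc _ s, (S_comm_T hs le_rfl).eq, ← mul_assoc,
              mul_assoc _ s, (S_comm_FF hs le_rfl i i).eq, ← mul_assoc]
        _ = _ := by
            rw [T_mul_X_right_pow (by omega), mul_add, add_mul, add_mul, key1, key2]
            simp only [mul_add, add_mul, mul_neg, neg_mul, mul_assoc, pow_zero, one_mul,
              ← (S_comm_FF hs le_rfl i i).eq, ← (S_comm_T hr le_rfl).left_comm, sub_eq_add_neg]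
    rw [this]
    refine mul_mem_timesR _ (sub_mem ?_ ?_)
    · exact mem_gammaPart_TT a (mul_mem hr (pow_mem (X_mem_S (by omega)) _))
        (mul_mem (T_mem_S (by omega)) (S_mono (by omega) hs))
    · exact mem_gammaPart_T a (Nat.zero_le _) (S_mono (by omega)
        (mul_mem (mul_mem hr (F_mem_S (by omega) i)) hs))
  · intro h0 w s hs
    show T Q N m * (w * cycGen Q N a * s) * X Q N m ^ 2 * T Q N m * FF Q N m i i ∈ _
    refine mul_mem_timesR _ (cycPart_le_gammaPart _ _ _ ?_)
    have hc := cycGen_mem_S (Q := Q) (N := N) a h0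
    have : T Q N m * (w * cycGen Q N a * s) * X Q N m ^ 2 * T Q N m =
        T Q N m * w * X Q N m ^ 2 * T Q N m * cycGen Q N a * s := by
      rw [← mul_assoc, mul_assoc _ s, ((S_comm_X hs le_rfl).pow_right 2).eq, ← mul_assoc,
        mul_assoc _ s, (S_comm_T hs le_rfl).eq, ← mul_assoc, ← mul_assoc,
        mul_assoc _ (cycGen Q N a), ((S_comm_X hc le_rfl).pow_right 2).eq, ← mul_assoc,
        mul_assoc _ (cycGen Q N a), (S_comm_T hc le_rfl).eq, ← mul_assoc]
    rw [this]
    exact mem_cycPart a (by omega) _ (S_mono (by omega) hs)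

/-- Comparison of the two filtrations. -/
theorem gammaPart_timesR_le (a : I → Polynomial k) {m : ℕ} (hm : m + 1 < N) (i : I) (d : ℕ) :
    timesR (gammaPart Q N a m d) (FF Q N m i i) ≤
      timesR (lowerPart Q N a (m + 1) d) (FF Q N m i i) := by
  rw [AddSubgroup.map_le_iff_le_comap]
  intro y hy
  change AddMonoidHom.mulRight (FF Q N m i i) y ∈ timesR (lowerPart Q N a (m + 1) d) (FF Q N m i i)
  refine gammaPart_le_of (AddMonoidHom.mulRight (FF Q N m i i)) ?_ ?_ ?_ ?_ hy
  · exact fun b hb r hr => mul_mem_timesR _ (polyPart_le _ _ _ (mem_polyPart hb hr))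
  -- Sliding x^b to the left through τ leaves a crossing term and a divided difference of degree at
  -- most b - 1; hence b = d is harmless.
  · intro b hb r hr
    show T Q N m * X Q N (m + 1) ^ b * r * FF Q N m i i ∈ _
    have : T Q N m * X Q N (m + 1) ^ b * r * FF Q N m i i =
        (X Q N m ^ b * T Q N m * r + hsum Q N m b * (F Q N m i * r)) * FF Q N m i i := by
      rw [T_mul_X_right_pow hm, add_mul, add_mul, add_mul]
      congr 1
      rw [FF, (F_comm_F m (m + 1) i i).eq, ← mul_assoc, mul_assoc _ r, (S_comm_F hr le_rfl i).eq,
        mul_assoc _ (Dl Q N m), ← mul_assoc (Dl Q N m), Dl_mul_F hm, mul_assoc (F Q N m i),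
        ← (S_comm_F hr le_rfl i).eq]
      simp only [mul_assoc]
    rw [this]
    refine mul_mem_timesR _ (add_mem (crossPart_le _ _ _ ?_) (polyPart_le _ _ _ ?_))
    · exact mem_crossPart (pow_mem (X_mem_S (by omega)) _) hr
    · rw [hsum, Finset.sum_mul]
      refine sum_mem fun c hc => ?_
      have := Finset.mem_range.1 hc
      rw [((X_comm m (m + 1)).pow_pow _ _).eq, mul_assoc]
      exact mem_polyPart (by omega)
        (mul_mem (pow_mem (X_mem_S (by omega)) _) (mul_mem (F_mem_S (by omega) i) hr))
  · rintro l rfl r hr s hs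
    exact mul_mem_timesR _ (crossPart_le _ _ _ (mem_crossPart
      (mul_mem (S_mono (by omega) hr) (T_mem_S (by omega))) hs))
  · exact fun w s hs => mul_mem_timesR _ (cycPart_le _ _ _ (mem_cycPart a (by omega) _ hs))

end Steps

/-! ### The leading term of θ_m, by induction on m. -/

section LeadingTerm

variable {I k : Type*} [Fintype I] [DecidableEq I] [CommRing k]
variable (Q : I → I → MvPolynomial (Fin 2) k) (N : ℕ)

/-- The idempotent `e(ν)` for the first `N` entries of the sequence `ν`. -/
def E (ν : ℕ → I) : Alg Q N := e Q fun l : Fin N => ν l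

variable {Q N}

theorem F_mul_E {l : ℕ} {ν : ℕ → I} {j : I} (h : ν l = j) : F Q N l j * E Q N ν = E Q N ν := by
  rw [F, E, idem_mul_e, if_pos fun _ => h]

theorem FF_mul_E {l : ℕ} {ν : ℕ → I} {j j' : I} (h : ν l = j) (h' : ν (l + 1) = j') :
    FF Q N l j j' * E Q N ν = E Q N ν := by
  rw [FF, mul_assoc, F_mul_E h', F_mul_E h]

theorem T_mul_E {l : ℕ} (h : l + 1 < N) (ν : ℕ → I) :
    T Q N l * E Q N ν = E Q N (ν ∘ Equiv.swap l (l + 1)) * T Q N l := by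
  rw [E, tau_mul_e h, E]
  congr 2
  funext m
  simp [sPerm_val]

theorem X_comm_E (l : ℕ) (ν : ℕ → I) : Commute (X Q N l) (E Q N ν) := X_mul_e _ _

/-- The correction `Dl` vanishes on distinct colours. -/
theorem T_mul_X_right_pow_E {m : ℕ} (hm : m + 1 < N) {i : I} {ν : ℕ → I} (h : ν m ≠ i)
    (h' : ν (m + 1) = i) (b : ℕ) :
    T Q N m * X Q N (m + 1) ^ b * E Q N ν = X Q N m ^ b * T Q N m * E Q N ν := by
  rw [T_mul_X_right_pow hm, add_mul, ← FF_mul_E rfl h', mul_assoc (hsum Q N m b), ← mul_assoc (Dl _ _ _),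
    Dl_mul_FF_of_ne hm h, zero_mul, mul_zero, add_zero]

/-- The hypotheses on the polynomials `Q_{ij}` and `a_i` which determine the leading term of
`τ_m ⋯ τ_1 a(x_1) τ_1 ⋯ τ_m` for a strand of colour `i`. -/
structure LeadingData (Q : I → I → MvPolynomial (Fin 2) k) (a : I → Polynomial k) (i : I)
    (L : ℕ) (d : I → ℕ) (t : I → k) : Prop where
  diag : Q i i = 0
  lead : ∃ r : ℕ → k,
    a i = ∑ b ∈ Finset.range L, Polynomial.monomial b (r b) + Polynomial.monomial L 1
  right : ∀ j, j ≠ i → ∀ u ∈ (Q j i).support, u 1 < d j ∨ u = Finsupp.single 1 (d j)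
  coeff : ∀ j, j ≠ i → (Q j i).coeff (Finsupp.single 1 (d j)) = t j
  left : ∀ j, j ≠ i → ∀ u ∈ (Q i j).support, u 0 ≤ d j

/-- The number of entries `i` among the first `m` entries of `ν`. -/
def cnt (i : I) (ν : ℕ → I) (m : ℕ) : ℕ := ∑ l ∈ Finset.range m, if ν l = i then 1 else 0

/-- The degree of the leading term. -/
def topDeg (i : I) (L : ℕ) (d : I → ℕ) (ν : ℕ → I) (m : ℕ) : ℕ :=
  L + ∑ l ∈ Finset.range m, if ν l = i then 0 else d (ν l)

/-- The coefficient of the leading term. -/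
def topCoeff (i : I) (t : I → k) (ν : ℕ → I) (m : ℕ) : k :=
  ∏ l ∈ Finset.range m, if ν l = i then -1 else t (ν l)

variable {a : I → Polynomial k} {i : I} {L : ℕ} {d : I → ℕ} {t : I → k}

theorem swap_agree (ν : ℕ → I) {m l : ℕ} (h : l ∈ Finset.range m) :
    (ν ∘ Equiv.swap m (m + 1)) l = ν l := by
  have := Finset.mem_range.1 h
  rw [Function.comp_apply, Equiv.swap_apply_of_ne_of_ne] <;> omega

theorem cnt_swap (ν : ℕ → I) (m : ℕ) : cnt i (ν ∘ Equiv.swap m (m + 1)) m = cnt i ν m :=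
  Finset.sum_congr rfl fun l hl => by rw [swap_agree ν hl]

theorem topDeg_swap (ν : ℕ → I) (m : ℕ) :
    topDeg i L d (ν ∘ Equiv.swap m (m + 1)) m = topDeg i L d ν m :=
  congrArg (L + ·) (Finset.sum_congr rfl fun l hl => by rw [swap_agree ν hl])

theorem topCoeff_swap (ν : ℕ → I) (m : ℕ) :
    topCoeff i t (ν ∘ Equiv.swap m (m + 1)) m = topCoeff i t ν m :=
  Finset.prod_congr rfl fun l hl => by rw [swap_agree ν hl]

/-- The statement on the leading term of `τ_m ⋯ τ_1 a(x_1) τ_1 ⋯ τ_m`. -/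
def HasLeadingTerm (Q : I → I → MvPolynomial (Fin 2) k) (N : ℕ) (a : I → Polynomial k) (i : I)
    (L : ℕ) (d : I → ℕ) (t : I → k) (ν : ℕ → I) (m : ℕ) : Prop :=
  ∃ y ∈ lowerPart Q N a m (topDeg i L d ν m),
    theta Q N a m * X Q N m ^ (2 * cnt i ν m) * E Q N ν =
      (topCoeff i t ν m • X Q N m ^ topDeg i L d ν m + y) * E Q N ν

/-- On colour i, θ_0 is a_i(x_1), which is monic of degree L. At m = 0 the only errors are
polynomials in x_1 of smaller degree over k. -/
theorem hasLeadingTerm_zero (h : LeadingData Q a i L d t) (h0 : 0 < N) {ν : ℕ → I} (hν : ν 0 = i) :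
    HasLeadingTerm Q N a i L d t ν 0 := by
  obtain ⟨r, hr⟩ := h.lead
  have ha : Polynomial.aeval (X Q N 0) (a i) =
      ∑ b ∈ Finset.range L, r b • X Q N 0 ^ b + X Q N 0 ^ L := by
    simp [hr, Polynomial.aeval_monomial, Algebra.smul_def]
  refine ⟨∑ b ∈ Finset.range L, r b • X Q N 0 ^ b, ?_, ?_⟩
  · refine polyPart_le _ _ _ (sum_mem fun b hb => ?_)
    rw [← mul_one (X Q N 0 ^ b), ← mul_smul_comm]
    exact mem_polyPart (by simpa [topDeg] using hb) (Subalgebra.smul_mem _ (one_mem _) _)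
  · have h1 : cycGen Q N a * E Q N ν = Polynomial.aeval (X Q N 0) (a i) * E Q N ν := by
      rw [cycGen, Finset.sum_mul, Finset.sum_eq_single i]
      · rw [mul_assoc, F_mul_E hν]
      · intro j _ hj
        rw [← F_mul_E hν, mul_assoc, ← mul_assoc (F _ _ _ _), F_mul_F_of_ne h0 hj, zero_mul,
          mul_zero]
      · simp
    simp only [cnt, topDeg, topCoeff, Finset.range_zero, Finset.sum_empty, Finset.prod_empty,
      mul_zero, pow_zero, mul_one, add_zero, one_smul, theta]
    rw [h1, ha, add_comm]

/-- The crossing carries the strand i from position m+2 to position m+1, so the induction hypothesis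
concerns the swapped sequence; its first m entries, and hence its numerical data, are those of ν. -/
theorem hasLeadingTerm_succ_of_ne (h : LeadingData Q a i L d t) {m : ℕ} (hm : m + 1 < N)
    {ν : ℕ → I} (hν : ν (m + 1) = i) (hj : ν m ≠ i)
    (ih : HasLeadingTerm Q N a i L d t (ν ∘ Equiv.swap m (m + 1)) m) :
    HasLeadingTerm Q N a i L d t ν (m + 1) := by
  obtain ⟨y, hy, hθ⟩ := ih
  rw [cnt_swap, topDeg_swap, topCoeff_swap] at hθ
  rw [topDeg_swap] at hy
  obtain ⟨y', hy', hyy'⟩ := cross_ne hm hj (h.right _ hj) (h.left _ hj) hy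
  change y' * FF Q N m (ν m) i = _ at hyy'
  have hp : cnt i ν (m + 1) = cnt i ν m := by rw [cnt, Finset.sum_range_succ, if_neg hj]; rfl
  have hM : topDeg i L d ν (m + 1) = topDeg i L d ν m + d (ν m) := by
    rw [topDeg, Finset.sum_range_succ, if_neg hj, ← add_assoc]; rfl
  have hc : topCoeff i t ν (m + 1) = topCoeff i t ν m * t (ν m) := by
    rw [topCoeff, Finset.prod_range_succ, if_neg hj]; rfl
  set M := topDeg i L d ν m
  set c := topCoeff i t ν m
  have hlead := pow_mul_evalPair_sub_mem (Q := Q) (N := N) (m := m) (b := M) (h.right _ hj)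
  rw [h.coeff _ hj] at hlead
  have hc' : c • (X Q N (m + 1) ^ M * evalPair (Q (ν m) i) (X Q N m) (X Q N (m + 1)) -
      t (ν m) • X Q N (m + 1) ^ (M + d (ν m))) ∈ polyPart Q N (m + 1) (M + d (ν m)) := by
    rw [← mul_one (_ - _), ← mul_smul_comm]
    exact polyPart_mul hlead (Subalgebra.smul_mem _ (one_mem _) _)
  refine ⟨c • (X Q N (m + 1) ^ M * evalPair (Q (ν m) i) (X Q N m) (X Q N (m + 1)) -
    t (ν m) • X Q N (m + 1) ^ (M + d (ν m))) + y', ?_, ?_⟩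
  · rw [hM]
    exact add_mem (polyPart_le _ _ _ hc') hy'
  · have e1 : T Q N m * X Q N m ^ M * T Q N m * E Q N ν =
        X Q N (m + 1) ^ M * evalPair (Q (ν m) i) (X Q N m) (X Q N (m + 1)) * E Q N ν := by
      rw [← FF_mul_E rfl hν, ← mul_assoc, T_mul_X_pow_mul_T_of_ne hm hj, mul_assoc]
    have e2 : T Q N m * y * T Q N m * E Q N ν = y' * E Q N ν := by
      rw [← FF_mul_E rfl hν, ← mul_assoc, ← hyy', mul_assoc]
    rw [hp, hM, hc, theta]
    calc _ = T Q N m * (theta Q N a m * X Q N m ^ (2 * cnt i ν m) *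
            E Q N (ν ∘ Equiv.swap m (m + 1))) * T Q N m := by
          rw [mul_assoc _ _ (E Q N ν), mul_assoc _ (T Q N m), ← mul_assoc (T Q N m) (_ ^ _),
            T_mul_X_right_pow_E hm hj hν, mul_assoc _ (T Q N m) (E Q N ν), T_mul_E hm]
          simp only [mul_assoc]
      _ = T Q N m * (c • X Q N m ^ M + y) * T Q N m * E Q N ν := by
          rw [hθ, ← mul_assoc, mul_assoc _ (E _ _ _), ← T_mul_E hm, ← mul_assoc]
      _ = c • (T Q N m * X Q N m ^ M * T Q N m * E Q N ν) + T Q N m * y * T Q N m * E Q N ν := by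
          simp only [mul_add, add_mul, mul_smul_comm, smul_mul_assoc]
      _ = _ := by
          rw [e1, e2, mul_smul, ← smul_mul_assoc, ← add_mul, smul_sub, ← add_assoc, add_sub_cancel]

/-- The leading term when the strand next to the end also has colour `i`. -/
theorem theta_succ_self (h : LeadingData Q a i L d t) {m : ℕ} (hm : m + 1 < N)
    {ν : ℕ → I} (hν : ν (m + 1) = i) (hj : ν m = i) (ih : HasLeadingTerm Q N a i L d t ν m) :
    ∃ y ∈ gammaPart Q N a m (topDeg i L d ν m),
      theta Q N a (m + 1) * X Q N (m + 1) ^ (2 * cnt i ν m + 2) * E Q N ν =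
        (-(topCoeff i t ν m • (T Q N m * X Q N (m + 1) ^ (topDeg i L d ν m + 1))) + y) *
          E Q N ν := by
  obtain ⟨y, hy, hθ⟩ := ih
  obtain ⟨y', hy', hyy'⟩ := cross_self hm h.diag hy
  change y' * FF Q N m i i = _ at hyy'
  set M := topDeg i L d ν m
  set c := topCoeff i t ν m
  set p := cnt i ν m
  have hsw : ν ∘ Equiv.swap m (m + 1) = ν := by
    funext l
    rcases eq_or_ne l m with rfl | h1
    · simp [hν, hj]
    rcases eq_or_ne l (m + 1) with rfl | h2
    · simp [hν, hj]
    rw [Function.comp_apply, Equiv.swap_apply_of_ne_of_ne h1 h2]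
  have hTE : T Q N m * E Q N ν = E Q N ν * T Q N m := by rw [T_mul_E hm, hsw]
  have hGE := FF_mul_E (Q := Q) (N := N) hj hν
  -- In `hsum` (M+2) the only term of degree M+1 in the new variable is its pure power; all others
  -- contain x_{m+1} and have degree at most M.
  have hlead : c • (T Q N m * hsum Q N m (M + 2) - T Q N m * X Q N (m + 1) ^ (M + 1)) ∈
      gammaPart Q N a m M := by
    rw [hsum_succ_left, mul_add, add_sub_cancel_right, ← mul_assoc, ← mul_smul_comm]
    exact T_mul_hsum_mem a le_rfl (Subalgebra.smul_mem _ (X_mem_S (by omega)) _)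
  -- The divided difference created by moving x^{2p+2} through the right-hand crossing: powers of
  -- x_{m+2} commute with everything in θ_m and can be put to the left of a(x_1).
  have hcyc : T Q N m * theta Q N a m * hsum Q N m (2 * p + 2) ∈ cycPart Q N a (m + 1) := by
    obtain ⟨w, s, hs, hw⟩ := theta_eq (Q := Q) (N := N) a m
    rw [hw, hsum, Finset.mul_sum]
    refine sum_mem fun b _ => ?_
    have e : T Q N m * (w * cycGen Q N a * s) *
        (X Q N m ^ b * X Q N (m + 1) ^ (2 * p + 2 - 1 - b)) =
        T Q N m * w * X Q N (m + 1) ^ (2 * p + 2 - 1 - b) * cycGen Q N a * (s * X Q N m ^ b) := by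
      have c1 := ((S_comm_X (cycGen_mem_S (Q := Q) (N := N) a (by omega : 0 < m + 1))
        le_rfl).pow_right (2 * p + 2 - 1 - b))
      have c2 := (S_comm_X hs le_rfl).pow_right (2 * p + 2 - 1 - b)
      simp only [mul_assoc, ((X_comm m (m + 1)).pow_pow _ _).eq, c2.left_comm, c1.left_comm]
    rw [e]
    exact mem_cycPart a (by omega) _ (mul_mem hs (pow_mem (X_mem_S (by omega)) _))
  refine ⟨-(c • (T Q N m * hsum Q N m (M + 2) - T Q N m * X Q N (m + 1) ^ (M + 1))) + y' +
    T Q N m * theta Q N a m * hsum Q N m (2 * p + 2),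
    add_mem (add_mem (neg_mem hlead) hy') (cycPart_le_gammaPart _ _ _ hcyc), ?_⟩
  have e0 : T Q N m * X Q N (m + 1) ^ (2 * p + 2) * E Q N ν =
      X Q N m ^ (2 * p + 2) * T Q N m * E Q N ν + hsum Q N m (2 * p + 2) * E Q N ν := by
    rw [T_mul_X_right_pow hm, add_mul, mul_assoc (hsum _ _ _ _), ← hGE, ← mul_assoc (Dl _ _ _),
      Dl_mul_FF_self hm, hGE]
  have e1 : T Q N m * X Q N m ^ (M + 2) * T Q N m * E Q N ν =
      -(T Q N m * hsum Q N m (M + 2) * E Q N ν) := by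
    rw [← hGE, ← mul_assoc, T_mul_X_pow_mul_T_self hm h.diag, neg_mul, mul_assoc _ _ (E _ _ _), hGE]
  have e2 : T Q N m * y * X Q N m ^ 2 * T Q N m * E Q N ν = y' * E Q N ν := by
    rw [← hGE, ← mul_assoc, ← hyy', mul_assoc]
  rw [theta]
  calc _ = T Q N m * (theta Q N a m * X Q N m ^ (2 * p) * E Q N ν) * X Q N m ^ 2 * T Q N m +
        T Q N m * theta Q N a m * hsum Q N m (2 * p + 2) * E Q N ν := by
        rw [mul_assoc _ _ (E Q N ν), mul_assoc _ (T Q N m), ← mul_assoc (T Q N m) (_ ^ _), e0,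
          mul_add, pow_add]
        congr 1
        · simp only [mul_assoc, hTE, ((X_comm_E m ν).pow_left 2).left_comm]
        · simp only [mul_assoc]
    _ = T Q N m * (c • X Q N m ^ M + y) * X Q N m ^ 2 * T Q N m * E Q N ν +
        T Q N m * theta Q N a m * hsum Q N m (2 * p + 2) * E Q N ν := by
        rw [hθ]
        congr 1
        simp only [mul_assoc, hTE, ((X_comm_E m ν).pow_left 2).left_comm]
    _ = c • (T Q N m * X Q N m ^ (M + 2) * T Q N m * E Q N ν) +
        T Q N m * y * X Q N m ^ 2 * T Q N m * E Q N ν +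
        T Q N m * theta Q N a m * hsum Q N m (2 * p + 2) * E Q N ν := by
        simp only [mul_add, add_mul, mul_smul_comm, smul_mul_assoc, pow_add, mul_assoc]
    _ = _ := by
        rw [e1, e2]
        simp only [add_mul, neg_mul, sub_mul, smul_sub, smul_neg, smul_mul_assoc]
        abel

/-- Returns to the form of the induction hypothesis by expanding τ x^{M+1}; its divided difference
contributes x^M, so the degree stays the same and the coefficient changes sign. -/
theorem hasLeadingTerm_succ_self (h : LeadingData Q a i L d t) {m : ℕ} (hm : m + 1 < N)
    {ν : ℕ → I} (hν : ν (m + 1) = i) (hj : ν m = i) (ih : HasLeadingTerm Q N a i L d t ν m) :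
    HasLeadingTerm Q N a i L d t ν (m + 1) := by
  obtain ⟨y, hy, hθ⟩ := theta_succ_self h hm hν hj ih
  have hp : cnt i ν (m + 1) = cnt i ν m + 1 := by rw [cnt, Finset.sum_range_succ, if_pos hj]; rfl
  have hM : topDeg i L d ν (m + 1) = topDeg i L d ν m := by
    rw [topDeg, Finset.sum_range_succ, if_pos hj]; rfl
  have hc : topCoeff i t ν (m + 1) = -topCoeff i t ν m := by
    rw [topCoeff, Finset.prod_range_succ, if_pos hj, mul_neg_one]; rfl
  set M := topDeg i L d ν m
  set c := topCoeff i t ν m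
  have hGE := FF_mul_E (Q := Q) (N := N) hj hν
  obtain ⟨y', hy', hyy'⟩ := gammaPart_timesR_le a hm i M (mul_mem_timesR _ hy)
  change y' * FF Q N m i i = _ at hyy'
  have e2 : y * E Q N ν = y' * E Q N ν := by
    rw [← hGE, ← mul_assoc, ← hyy', mul_assoc]
  have e1 : T Q N m * X Q N (m + 1) ^ (M + 1) * E Q N ν =
      (X Q N (m + 1) ^ M + (X Q N m ^ (M + 1) * T Q N m + hsum Q N m M * X Q N m)) * E Q N ν := by
    rw [T_mul_X_right_pow hm, add_mul, mul_assoc (hsum _ _ _ _), ← hGE, ← mul_assoc (Dl _ _ _),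
      Dl_mul_FF_self hm, hGE, hsum_succ_left]
    simp only [add_mul]
    abel
  have hlow : c • (X Q N m ^ (M + 1) * T Q N m + hsum Q N m M * X Q N m) ∈
      lowerPart Q N a (m + 1) M := by
    rw [smul_add]
    refine add_mem (crossPart_le _ _ _ ?_) (polyPart_le _ _ _ ?_)
    · rw [← mul_one (_ * _), ← mul_smul_comm]
      exact mem_crossPart (pow_mem (X_mem_S (by omega)) _) (Subalgebra.smul_mem _ (one_mem _) _)
    · rw [← mul_smul_comm, hsum, Finset.sum_mul]
      refine sum_mem fun b hb => ?_
      have := Finset.mem_range.1 hb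
      rw [((X_comm m (m + 1)).pow_pow _ _).eq, mul_assoc]
      exact mem_polyPart (by omega) (mul_mem (pow_mem (X_mem_S (by omega)) _)
        (Subalgebra.smul_mem _ (X_mem_S (by omega)) _))
  refine ⟨-(c • (X Q N m ^ (M + 1) * T Q N m + hsum Q N m M * X Q N m)) + y', ?_, ?_⟩
  · rw [hM]
    exact add_mem (neg_mem hlow) hy'
  · rw [hp, hM, hc, mul_add, mul_one, hθ, add_mul, neg_mul, smul_mul_assoc, e1, e2]
    simp only [add_mul, neg_mul, neg_smul, smul_add, smul_mul_assoc]
    abel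

/-- The sequence must be arbitrary in the induction, as crossing a different colour replaces ν by
its swap. -/
theorem hasLeadingTerm (h : LeadingData Q a i L d t) (m : ℕ) (hm : m < N) (ν : ℕ → I)
    (hν : ν m = i) : HasLeadingTerm Q N a i L d t ν m := by
  induction m generalizing ν with
  | zero => exact hasLeadingTerm_zero h hm hν
  | succ m ih =>
    by_cases hj : ν m = i
    · exact hasLeadingTerm_succ_self h hm hν hj (ih (by omega) ν hj)
    · exact hasLeadingTerm_succ_of_ne h hm hν hj (ih (by omega) _ (by simpa using hν))

end LeadingTerm

/-! ### Generation of R(n), the map R(n) → R(n+1), and the tail idempotents. -/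

section Embedding

variable {I k : Type*} [Fintype I] [DecidableEq I] [CommRing k]
variable {Q : I → I → MvPolynomial (Fin 2) k} {n : ℕ}

theorem eq_top_of_generators {U : Subalgebra k (Alg Q n)} (he : ∀ ν, e Q ν ∈ U)
    (hX : ∀ l < n, X Q n l ∈ U) (hT : ∀ l, l + 1 < n → T Q n l ∈ U) : U = ⊤ := by
  have h : U.comap (Alg.mk Q n) = ⊤ := by
    rw [eq_top_iff, ← FreeAlgebra.adjoin_range_ι]
    refine Algebra.adjoin_le ?_
    rintro _ ⟨g, rfl⟩
    cases g with
    | e ν => exact he ν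
    | x l => have := hX l l.2; rwa [X_eq l.2] at this
    | tau l hl => have := hT l hl; rwa [T_eq hl] at this
  refine eq_top_iff.2 fun z _ => ?_
  obtain ⟨w, rfl⟩ := RingQuot.mkAlgHom_surjective k (Rel Q n) z
  have hw : w ∈ U.comap (Alg.mk Q n) := by rw [h]; trivial
  exact hw

theorem commute_of_generators {c : Alg Q n} (he : ∀ ν, Commute (e Q ν) c)
    (hX : ∀ l < n, Commute (X Q n l) c) (hT : ∀ l, l + 1 < n → Commute (T Q n l) c)
    (z : Alg Q n) : Commute z c := by
  have h : Subalgebra.centralizer k {c} = ⊤ := eq_top_of_generators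
    (by rintro ν _ rfl; exact (he ν).symm) (by rintro l hl _ rfl; exact (hX l hl).symm)
    (by rintro l hl _ rfl; exact (hT l hl).symm)
  have hz : z ∈ Subalgebra.centralizer k {c} := by rw [h]; trivial
  exact (hz c rfl).symm

theorem wt_comp (ν : Fin n → I) (σ : Equiv.Perm (Fin n)) : wt (ν ∘ σ) = wt ν := by
  rw [wt, wt]
  exact Equiv.sum_comp σ fun l => (Pi.single (ν l) 1 : I → ℕ)

/-- A crossing permutes the entries of a sequence and so preserves its weight. -/
theorem eWt_comm (β : I → ℕ) (z : Alg Q n) : Commute z (eWt Q n β) := by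
  refine commute_of_generators (fun ν => ?_) (fun l _ => X_comm_idem l _) (fun l hl => ?_) z
  · change e Q ν * idem Q n _ = idem Q n _ * e Q ν
    rw [e_mul_idem, idem_mul_e]
  · exact T_mul_idem fun h ν => by rw [wt_comp]

theorem emb_mk (w : FreeAlgebra k (Gen I n)) : emb Q n (Alg.mk Q n w) = embFree Q n w :=
  RingQuot.liftAlgHom_mkAlgHom_apply _ _ _ _

theorem emb_X {l : ℕ} (h : l < n) : emb Q n (X Q n l) = X Q (n + 1) l := by
  rw [X_eq h, X_eq (by omega : l < n + 1), ← mk_fx, emb_mk, embFree_x]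
  rfl

theorem emb_T {l : ℕ} (h : l + 1 < n) : emb Q n (T Q n l) = T Q (n + 1) l := by
  rw [T_eq h, T_eq (by omega : l + 1 < n + 1), ← mk_ft, emb_mk, embFree_t]

theorem emb_e_mul_e (ν : Fin n → I) (μ : Fin (n + 1) → I) :
    emb Q n (e Q ν) * e Q μ = if Fin.init μ = ν then e Q μ else 0 := by
  rw [← mk_fe, emb_mk, embFree_e, Finset.sum_mul]
  split_ifs with h
  · rw [Finset.sum_eq_single (μ (Fin.last n))]
    · rw [e_mul_e, ← h, Fin.snoc_init_self, if_pos rfl]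
    · intro j _ hj
      rw [e_mul_e, if_neg]
      rintro rfl
      simp at hj
    · simp
  · refine Finset.sum_eq_zero fun j _ => ?_
    rw [e_mul_e, if_neg]
    rintro rfl
    simp at h

theorem emb_idem (p : (Fin n → I) → Prop) [DecidablePred p] :
    emb Q n (idem Q n p) = idem Q (n + 1) fun μ => p (Fin.init μ) := by
  refine ext_e fun μ => ?_
  rw [idem_mul_e, idem, map_sum, Finset.sum_mul]
  simp [emb_e_mul_e]

theorem emb_F {l : ℕ} (h : l < n) (j : I) : emb Q n (F Q n l j) = F Q (n + 1) l j := by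
  rw [F, emb_idem, F]
  refine idem_congr fun ν => ?_
  simp only [h, (by omega : l < n + 1), forall_true_left]
  rfl

theorem emb_cycGen (a : I → Polynomial k) (h : 0 < n) :
    emb Q n (cycGen Q n a) = cycGen Q (n + 1) a := by
  rw [cycGen, map_sum]
  refine Finset.sum_congr rfl fun j _ => ?_
  rw [map_mul, emb_F h, ← Polynomial.aeval_algHom_apply, emb_X h]

/-- The preimage is kept inside `S`, so that the descent can be repeated down to R(n). -/
theorem exists_emb_eq {m : ℕ} (h : m ≤ n) {r : Alg Q (n + 1)} (hr : r ∈ S Q (n + 1) m) :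
    ∃ r' ∈ S Q n m, emb Q n r' = r := by
  have : S Q (n + 1) m ≤ (S Q n m).map (emb Q n) := by
    refine Algebra.adjoin_le ?_
    rintro z ((⟨l, hl, rfl⟩ | ⟨l, hl, j, rfl⟩) | ⟨l, hl, rfl⟩)
    exacts [⟨_, X_mem_S hl, emb_X (by omega)⟩, ⟨_, F_mem_S hl j, emb_F (by omega) j⟩,
      ⟨_, T_mem_S hl, emb_T (by omega)⟩]
  exact this hr

/-- The image of e(ν) is not a single idempotent but a sum over the last colour, hence the
hypothesis on all `idem`. -/
theorem emb_comm {c : Alg Q (n + 1)} (he : ∀ p [DecidablePred p], Commute (idem Q (n + 1) p) c)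
    (hX : ∀ l < n, Commute (X Q (n + 1) l) c) (hT : ∀ l, l + 1 < n → Commute (T Q (n + 1) l) c)
    (z : Alg Q n) : Commute (emb Q n z) c := by
  have h : (Subalgebra.centralizer k {c}).comap (emb Q n) = ⊤ := by
    refine eq_top_of_generators ?_ ?_ ?_
    · rintro ν _ rfl
      have : e Q ν = idem Q n fun μ => μ = ν := by
        rw [idem, Finset.sum_filter]
        simp
      change _ * emb Q n (e Q ν) = emb Q n (e Q ν) * _
      rw [this, emb_idem]
      exact (he _).symm
    · rintro l hl _ rfl
      change _ * emb Q n (X Q n l) = emb Q n (X Q n l) * _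
      rw [emb_X hl]
      exact (hX l hl).symm
    · rintro l hl _ rfl
      change _ * emb Q n (T Q n l) = emb Q n (T Q n l) * _
      rw [emb_T hl]
      exact (hT l hl).symm
  have hz : z ∈ (Subalgebra.centralizer k {c}).comap (emb Q n) := by rw [h]; trivial
  exact (hz c rfl).symm

theorem emb_comm_F (z : Alg Q n) (j : I) : Commute (emb Q n z) (F Q (n + 1) n j) :=
  emb_comm (fun _ _ => idem_comm _ _) (fun _ _ => X_comm_F _ _ _)
    (fun _ _ => T_comm_F (by omega) (by omega) _) z

theorem emb_emb_comm_F (z : Alg Q n) (j : I) :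
    Commute (emb Q (n + 1) (emb Q n z)) (F Q (n + 2) n j) := by
  rw [← emb_F (by omega)]
  exact (emb_comm_F z j).map _

theorem wt_init (ν : Fin (n + 1) → I) :
    wt ν = wt (Fin.init ν : Fin n → I) + Pi.single (ν (Fin.last n)) 1 := by
  rw [wt, wt, Fin.sum_univ_castSucc]
  rfl

theorem eTail_one (β : I → ℕ) (i : I) :
    eTail Q (n + 1) β i 1 = emb Q n (eWt Q n β) * F Q (n + 1) n i := by
  change idem _ _ _ = emb Q n (idem _ _ _) * idem _ _ _
  rw [emb_idem, idem_mul_idem]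
  refine idem_congr fun ν => ?_
  have h2 : (∀ l : Fin (n + 1), n + 1 ≤ (l : ℕ) + 1 → ν l = i) ↔ ν (Fin.last n) = i := by
    refine ⟨fun h => h _ (by simp), fun h l hl => ?_⟩
    rwa [(Fin.ext (by simp only [Fin.val_last]; omega) : l = Fin.last n)]
  have h3 : (∀ h : n < n + 1, ν ⟨n, h⟩ = i) ↔ ν (Fin.last n) = i :=
    ⟨fun h => h (by omega), fun h _ => h⟩
  rw [h2, h3, wt_init]
  refine and_congr_left fun h => ?_
  rw [h, add_left_inj]

theorem eTail_two (β : I → ℕ) (i : I) :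
    eTail Q (n + 2) β i 2 =
      eWt Q (n + 2) (β + Pi.single i 2) * (F Q (n + 2) n i * F Q (n + 2) (n + 1) i) := by
  change idem _ _ _ = idem _ _ _ * (idem _ _ _ * idem _ _ _)
  rw [idem_mul_idem, idem_mul_idem]
  refine idem_congr fun ν => and_congr_right fun _ => ?_
  refine ⟨fun h => ⟨fun h' => h _ (by simp), fun h' => h _ (by simp)⟩, fun h l hl => ?_⟩
  obtain ⟨l, hl'⟩ := l
  simp only at hl
  obtain rfl | rfl : l = n ∨ l = n + 1 := by omega
  exacts [h.1 hl', h.2 hl']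

theorem eTail_two' (β : I → ℕ) (i : I) :
    eTail Q (n + 2) β i 2 =
      emb Q (n + 1) (emb Q n (eWt Q n β)) * (F Q (n + 2) n i * F Q (n + 2) (n + 1) i) := by
  change idem _ _ _ = emb Q _ (emb Q _ (idem _ _ _)) * (idem _ _ _ * idem _ _ _)
  rw [emb_idem, emb_idem, idem_mul_idem, idem_mul_idem]
  refine idem_congr fun ν => ?_
  have h2 : (∀ l : Fin (n + 2), n + 2 ≤ (l : ℕ) + 2 → ν l = i) ↔
      (∀ h : n < n + 2, ν ⟨n, h⟩ = i) ∧ ∀ h : n + 1 < n + 2, ν ⟨n + 1, h⟩ = i := by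
    refine ⟨fun h => ⟨fun h' => h _ (by simp), fun h' => h _ (by simp)⟩, fun h l hl => ?_⟩
    obtain ⟨l, hl'⟩ := l
    simp only at hl
    obtain rfl | rfl : l = n ∨ l = n + 1 := by omega
    exacts [h.1 hl', h.2 hl']
  rw [h2, wt_init, wt_init]
  refine and_congr_left fun h => ?_
  have e1 : ν (Fin.last (n + 1)) = i := h.2 (by omega)
  have e2 : (Fin.init ν : Fin (n + 1) → I) (Fin.last n) = i := h.1 (by omega)
  rw [e1, e2, add_assoc, ← Pi.single_add, add_left_inj]

theorem cyc_eq (a : I → Polynomial k) (β : I → ℕ) (h : 0 < n) :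
    cyc Q a β (⟨0, h⟩ : Fin n) = cycGen Q n a * eWt Q n β := by
  refine ext_e fun μ => ?_
  change _ = cycGen Q n a * idem _ _ _ * _
  rw [mul_assoc, idem_mul_e, cyc, Finset.sum_mul]
  simp only [mul_assoc, e_mul_e, mul_ite, mul_zero, Finset.sum_ite_eq', Finset.mem_filter,
    Finset.mem_univ, true_and]
  split_ifs with hμ
  · rw [cycGen, Finset.sum_mul, Finset.sum_eq_single (μ ⟨0, h⟩)]
    · rw [mul_assoc, F, idem_mul_e, if_pos fun _ => rfl, X_eq h]
    · intro j _ hj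
      rw [mul_assoc, F, idem_mul_e, if_neg fun h' => hj (h' h).symm, mul_zero]
    · simp
  · rfl

end Embedding

/-! ### From `gammaPart` in R(n+2) to the filtration of K. -/

section Bimodule

variable {I k : Type*} [Fintype I] [DecidableEq I] [CommRing k]
variable {Q : I → I → MvPolynomial (Fin 2) k} {n : ℕ} {a : I → Polynomial k} {β : I → ℕ} {i : I}

/-- The element `e(β) r e(β)` of `R(β)`. -/
def toRBeta (β : I → ℕ) (r : Alg Q n) : RBeta Q n β := ⟨eWt Q n β * r * eWt Q n β, ⟨r, rfl⟩⟩

/-- The class in `R^Λ(β)` of `e(β) r e(β)`. -/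
def cls (Q : I → I → MvPolynomial (Fin 2) k) (a : I → Polynomial k) (n : ℕ) (β : I → ℕ)
    (r : Alg Q n) : RLambda Q a n β :=
  ((toRBeta β r : RBeta Q n β) : RLambda Q a n β)

/-- As e(β) is central, r ↦ e(β) r e(β) is multiplicative, and it sends a(x_1) to the generator of
the cyclotomic ideal. -/
theorem cls_cycGen_mul (hn : 0 < n) (s : Alg Q n) : cls Q a n β (cycGen Q n a * s) = 0 := by
  have h0 : toRBeta β (cycGen Q n a) ∈
      cycIdeal Q a n β := by
    refine TwoSidedIdeal.subset_span ⟨hn, ?_⟩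
    rw [cyc_eq]
    change eWt Q n β * cycGen Q n a * eWt Q n β = _
    rw [← (eWt_comm β _).eq, mul_assoc, eWt_idem]
  have h1 : cls Q a n β (cycGen Q n a * s) =
      ((toRBeta β (cycGen Q n a) * toRBeta β s : RBeta Q n β) : RLambda Q a n β) := by
    rw [cls]
    congr 1
    refine Subtype.ext ?_
    change eWt Q n β * (cycGen Q n a * s) * eWt Q n β =
      eWt Q n β * cycGen Q n a * eWt Q n β * (eWt Q n β * s * eWt Q n β)
    have hi : eWt Q n β * eWt Q n β = eWt Q n β := eWt_idem n β
    have hz : ∀ z : Alg Q n, eWt Q n β * z * eWt Q n β = z * eWt Q n β := fun z => by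
      rw [← (eWt_comm β z).eq, mul_assoc, hi]
    rw [hz, hz, hz, mul_assoc _ (eWt Q n β), ← mul_assoc (eWt Q n β) s, hz, mul_assoc]
  rw [h1]
  have h2 := TwoSidedIdeal.mul_mem_right _ _ (toRBeta β s) h0
  rw [TwoSidedIdeal.mem_iff] at h2
  exact (RingCon.eq _).2 h2

theorem toLeft_congr {w w' : Alg Q (n + 2)}
    (h : eTail Q (n + 2) β i 2 * (w * eTail Q (n + 2) (β + Pi.single i 1) i 1) =
      eTail Q (n + 2) β i 2 * (w' * eTail Q (n + 2) (β + Pi.single i 1) i 1)) :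
    toLeft n β i w = toLeft n β i w' := Subtype.ext h

theorem toLeft_add (w w' : Alg Q (n + 2)) :
    toLeft n β i (w + w') = toLeft n β i w + toLeft n β i w' :=
  Subtype.ext (by simp only [toLeft, add_mul, mul_add]; rfl)

/-- `w ↦ w ⊗ s` as an additive map. -/
def tmulHom (a : I → Polynomial k) (β : I → ℕ) (i : I)
    (s : RLambda Q a (n + 1) (β + Pi.single i 1)) : Alg Q (n + 2) →+ K Q a n β i :=
  AddMonoidHom.mk' (fun w => K.tmul a β i w s) fun w w' => by
    simp only [K.tmul, toLeft_add, TensorProduct.add_tmul]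
    rfl

theorem tmulHom_apply (s : RLambda Q a (n + 1) (β + Pi.single i 1)) (w : Alg Q (n + 2)) :
    tmulHom a β i s w = K.tmul a β i w s := rfl

theorem tmul_zero' (w : Alg Q (n + 2)) : K.tmul a β i w 0 = 0 := by
  rw [K.tmul, TensorProduct.tmul_zero]
  rfl

theorem eTail_one_idem (β : I → ℕ) (i : I) :
    eTail Q (n + 1) β i 1 * eTail Q (n + 1) β i 1 = eTail Q (n + 1) β i 1 := sum_e_idem _

theorem eTail_two_idem (β : I → ℕ) (i : I) :
    eTail Q (n + 2) β i 2 * eTail Q (n + 2) β i 2 = eTail Q (n + 2) β i 2 := sum_e_idem _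

theorem tmul_eTail_mul (w : Alg Q (n + 2)) (s : RLambda Q a (n + 1) (β + Pi.single i 1)) :
    K.tmul a β i (eTail Q (n + 2) β i 2 * w) s = K.tmul a β i w s := by
  rw [K.tmul, K.tmul]
  congr 2
  refine toLeft_congr ?_
  rw [mul_assoc, ← mul_assoc, eTail_two_idem]

theorem emb_comm_eTail_one (r : Alg Q n) (β : I → ℕ) :
    Commute (emb Q n r) (eTail Q (n + 1) β i 1) := by
  rw [eTail_one]
  exact ((eWt_comm β r).map _).mul_right (emb_comm_F r i)

/-- This is the balancing relation of K, freed from idempotents: those surrounding r are absorbed by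
e(β + α_i, i), which commutes with the image of R(n+1). -/
theorem tmul_mul_emb (w : Alg Q (n + 2)) (r : Alg Q (n + 1))
    (s : RLambda Q a (n + 1) (β + Pi.single i 1)) :
    K.tmul a β i (w * emb Q (n + 1) r) s =
      K.tmul a β i w (cls Q a (n + 1) (β + Pi.single i 1) r * s) := by
  have h : (QuotientAddGroup.mk (rightAct n β i (toLeft n β i w)
      (toRBeta (β + Pi.single i 1) r) ⊗ₜ[ℤ] s -
      toLeft n β i w ⊗ₜ[ℤ] (cls Q a (n + 1) (β + Pi.single i 1) r * s)) : K Q a n β i) = 0 :=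
    (QuotientAddGroup.eq_zero_iff _).2
      (AddSubgroup.subset_closure ⟨toLeft n β i w, toRBeta (β + Pi.single i 1) r, s, rfl⟩)
  rw [QuotientAddGroup.mk_sub, sub_eq_zero] at h
  rw [K.tmul, K.tmul, ← h]
  congr 2
  refine toLeft_congr ?_
  change _ = eTail Q (n + 2) β i 2 *
    (eTail Q (n + 2) β i 2 * (w * eTail Q (n + 2) (β + Pi.single i 1) i 1) *
      emb Q (n + 1) (eWt Q (n + 1) (β + Pi.single i 1) * r * eWt Q (n + 1) (β + Pi.single i 1)) *
        eTail Q (n + 2) (β + Pi.single i 1) i 1)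
  have hi : eWt Q (n + 1) (β + Pi.single i 1) * eWt Q (n + 1) (β + Pi.single i 1) =
      eWt Q (n + 1) (β + Pi.single i 1) := eWt_idem _ _
  have h1 : emb Q (n + 1) (eWt Q (n + 1) (β + Pi.single i 1)) *
      eTail Q (n + 2) (β + Pi.single i 1) i 1 = eTail Q (n + 2) (β + Pi.single i 1) i 1 := by
    rw [eTail_one, ← mul_assoc, ← map_mul, hi]
  have h2 : emb Q (n + 1) (eWt Q (n + 1) (β + Pi.single i 1) * r * eWt Q (n + 1) (β + Pi.single i 1)) *
      eTail Q (n + 2) (β + Pi.single i 1) i 1 =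
      emb Q (n + 1) r * eTail Q (n + 2) (β + Pi.single i 1) i 1 := by
    rw [mul_assoc, ← (eWt_comm (β + Pi.single i 1) (r * _)).eq, mul_assoc, hi, map_mul, mul_assoc, h1]
  rw [mul_assoc _ (emb _ _ (_ * r * _)) (eTail _ _ _ _ _), h2]
  have h3 : eTail Q (n + 2) (β + Pi.single i 1) i 1 *
      (emb Q (n + 1) r * eTail Q (n + 2) (β + Pi.single i 1) i 1) =
      emb Q (n + 1) r * eTail Q (n + 2) (β + Pi.single i 1) i 1 := by
    rw [← mul_assoc, ← (emb_comm_eTail_one r (β + Pi.single i 1)).eq, mul_assoc, eTail_one_idem]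
  rw [mul_assoc _ (w * _), mul_assoc w _ (_ * _), h3, mul_assoc w (emb _ _ r),
    ← mul_assoc (eTail Q (n + 2) β i 2) (eTail Q (n + 2) β i 2), eTail_two_idem]

/-- The right idempotent built into `toLeft` already fixes the last colour. -/
theorem tmul_mul_F (w : Alg Q (n + 2)) (s : RLambda Q a (n + 1) (β + Pi.single i 1)) :
    K.tmul a β i (w * F Q (n + 2) (n + 1) i) s = K.tmul a β i w s := by
  rw [K.tmul, K.tmul]
  congr 2
  refine toLeft_congr ?_
  rw [eTail_one, (emb_comm_F _ i).eq, mul_assoc w, ← mul_assoc (F Q (n + 2) (n + 1) i),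
    F_mul_self]

theorem gammaAux_mono {m m' : ℕ} (h : m ≤ m') : gammaAux Q a n β i m ≤ gammaAux Q a n β i m' := by
  induction h with
  | refl => exact le_rfl
  | step _ ih => exact ih.trans (le_sup_left.trans le_sup_left)

theorem tmul_X_pow_mem {b M : ℕ} (h : b < M) (s : RLambda Q a (n + 1) (β + Pi.single i 1)) :
    K.tmul a β i (X Q (n + 2) (n + 1) ^ b) s ∈ gammaAux Q a n β i M := by
  refine gammaAux_mono (h : b + 1 ≤ M) ?_
  rw [← tmul_eTail_mul, X_eq (by omega : n + 1 < n + 2)]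
  exact AddSubgroup.mem_sup_left (AddSubgroup.mem_sup_right (AddSubgroup.subset_closure ⟨s, rfl⟩))

theorem gammaNegOne_le (M : ℕ) : gammaNegOne Q a n β i ≤ gammaAux Q a n β i M :=
  gammaAux_mono (Nat.zero_le M)

theorem tmul_T_mul_X_pow_mem {b M : ℕ} (h : b ≤ M)
    (s : RLambda Q a (n + 1) (β + Pi.single i 1)) :
    K.tmul a β i (T Q (n + 2) n * X Q (n + 2) (n + 1) ^ b) s ∈ gammaAux Q a n β i M := by
  rw [← tmul_eTail_mul, ← mul_assoc, X_eq (by omega : n + 1 < n + 2),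
    T_eq (by omega : n + 1 < n + 2)]
  cases b with
  | zero =>
    rw [pow_zero, mul_one]
    exact gammaNegOne_le M (AddSubgroup.mem_sup_right (AddSubgroup.subset_closure ⟨s, rfl⟩))
  | succ b =>
    exact gammaAux_mono h (AddSubgroup.mem_sup_right (AddSubgroup.subset_closure ⟨s, rfl⟩))

theorem emb_emb_comm_eTail_two (r : Alg Q n) (β : I → ℕ) :
    Commute (emb Q (n + 1) (emb Q n r)) (eTail Q (n + 2) β i 2) := by
  rw [eTail_two']
  exact (((eWt_comm β r).map (emb Q n)).map (emb Q (n + 1))).mul_right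
    ((emb_emb_comm_F r i).mul_right (emb_comm_F _ i))

/-- Pulling e(β, i²) rightwards through both crossings moves its two colour conditions one place to
the left; with the condition on the last strand, the final three entries are all i. -/
theorem eTail_two_mul_T_mul_T (l : ℕ) (β : I → ℕ) (i : I) :
    eTail Q (l + 3) β i 2 * (T Q (l + 3) l * T Q (l + 3) (l + 1)) *
        eTail Q (l + 3) (β + Pi.single i 1) i 1 =
      T Q (l + 3) l * T Q (l + 3) (l + 1) * idem Q (l + 3) fun ν =>
        wt ν = β + Pi.single i 2 ∧ ∀ m : Fin (l + 3), l + 3 ≤ (m : ℕ) + 3 → ν m = i := by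
  have e1 : eTail Q (l + 3) β i 2 * (T Q (l + 3) l * T Q (l + 3) (l + 1)) =
      T Q (l + 3) l * T Q (l + 3) (l + 1) * (eWt Q (l + 3) (β + Pi.single i 2) *
        (F Q (l + 3) l i * F Q (l + 3) (l + 1) i)) := by
    rw [eTail_two (n := l + 1), ← mul_assoc _ (eWt _ _ _), (eWt_comm _ (_ * _)).eq,
      mul_assoc (eWt _ _ _), mul_assoc (eWt _ _ _)]
    congr 1
    rw [mul_assoc (F _ _ _ _), ← mul_assoc (F Q (l + 3) (l + 1 + 1) i),
      ← (T_comm_F (by omega) (by omega) i).eq, mul_assoc (T _ _ _), ← T_mul_F_left,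
      ← mul_assoc (F Q (l + 3) (l + 1) i), ← T_mul_F_left, mul_assoc (T _ _ l),
      ← mul_assoc (F Q (l + 3) l i), ← (T_comm_F (by omega) (by omega) i).eq]
    simp only [mul_assoc]
  rw [e1, mul_assoc]
  congr 1
  change idem _ _ _ * (idem _ _ _ * idem _ _ _) * idem _ _ _ = _
  rw [idem_mul_idem, idem_mul_idem, idem_mul_idem]
  refine idem_congr fun ν => ?_
  constructor
  · rintro ⟨⟨h1, h2, h3⟩, _, h5⟩
    refine ⟨h1, fun m hm => ?_⟩
    obtain ⟨m, hm'⟩ := m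
    simp only at hm
    obtain rfl | rfl | rfl : m = l ∨ m = l + 1 ∨ m = l + 2 := by omega
    exacts [h2 hm', h3 hm', h5 _ (by simp)]
  · rintro ⟨h1, h2⟩
    refine ⟨⟨h1, fun _ => h2 _ (by simp), fun _ => h2 _ (by simp)⟩, ?_, fun m hm => h2 _ (by omega)⟩
    rw [h1, add_assoc, ← Pi.single_add]

theorem wt_three {l : ℕ} {ν : Fin (l + 3) → I}
    (h : ∀ m : Fin (l + 3), l + 3 ≤ (m : ℕ) + 3 → ν m = i) :
    ∃ γ : I → ℕ, wt ν = γ + Pi.single i 3 := by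
  refine ⟨wt (Fin.init (Fin.init (Fin.init ν : Fin (l + 2) → I) : Fin (l + 1) → I) : Fin l → I), ?_⟩
  have h1 : ν (Fin.last _) = i := h _ (by simp)
  have h2 : (Fin.init ν : Fin (l + 2) → I) (Fin.last _) = i := h _ (by simp)
  have h3 : (Fin.init (Fin.init ν : Fin (l + 2) → I) : Fin (l + 1) → I) (Fin.last _) = i :=
    h _ (by simp)
  rw [wt_init, wt_init, wt_init, h1, h2, h3, add_assoc, add_assoc, ← Pi.single_add,
    ← Pi.single_add]
  rfl

/-- The idempotents force the tail i³. If β - α_i lies in Q⁺ this is a generator of Γ_{-1};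
otherwise no sequence of weight β + 2α_i ends in i³ and the element is zero. -/
theorem tmul_T_mul_T_mem (l M : ℕ) (r : Alg Q (l + 1))
    (s : RLambda Q a (l + 2) (β + Pi.single i 1)) :
    K.tmul a β i (emb Q (l + 2) (emb Q (l + 1) r) * T Q (l + 3) l * T Q (l + 3) (l + 1)) s ∈
      gammaAux Q a (l + 1) β i M := by
  have key : ∀ z, eTail Q (l + 3) β i 2 * (emb Q (l + 2) (emb Q (l + 1) z) * T Q (l + 3) l *
        T Q (l + 3) (l + 1) * eTail Q (l + 3) (β + Pi.single i 1) i 1) =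
      emb Q (l + 2) (emb Q (l + 1) z) * (T Q (l + 3) l * T Q (l + 3) (l + 1) *
        idem Q (l + 3) fun ν => wt ν = β + Pi.single i 2 ∧
          ∀ m : Fin (l + 3), l + 3 ≤ (m : ℕ) + 3 → ν m = i) := by
    intro z
    rw [← eTail_two_mul_T_mul_T]
    simp only [← mul_assoc, (emb_emb_comm_eTail_two z β).eq]
  by_cases hγ : ∃ γ : I → ℕ, γ + Pi.single i 1 = β
  · obtain ⟨γ, hγ⟩ := hγ
    refine gammaNegOne_le M (AddSubgroup.mem_sup_left (AddSubgroup.subset_closure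
      ⟨Nat.succ_pos l, γ, hγ, toRBeta β r, s, ?_⟩))
    rw [K.tmul, K.tmul]
    congr 2
    refine toLeft_congr ?_
    have h3 : eTail Q (l + 3) γ i 3 = idem Q (l + 3) fun ν => wt ν = β + Pi.single i 2 ∧
        ∀ m : Fin (l + 3), l + 3 ≤ (m : ℕ) + 3 → ν m = i := by
      refine idem_congr fun ν => ?_
      rw [← hγ, add_assoc, ← Pi.single_add]
    have h4 : eTail Q (l + 3) γ i 3 * eTail Q (l + 3) (β + Pi.single i 1) i 1 =
        eTail Q (l + 3) (β + Pi.single i 1) i 1 * eTail Q (l + 3) γ i 3 := (idem_comm _ _).eq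
    have h5 : eTail Q (l + 3) γ i 3 * eTail Q (l + 3) γ i 3 = eTail Q (l + 3) γ i 3 :=
      sum_e_idem _
    have h6 : eTail Q (l + 3) β i 2 *
        emb Q (l + 2) (emb Q (l + 1) (eWt Q (l + 1) β * r * eWt Q (l + 1) β)) =
        eTail Q (l + 3) β i 2 * emb Q (l + 2) (emb Q (l + 1) r) := by
      have hi : eWt Q (l + 1) β * eWt Q (l + 1) β = eWt Q (l + 1) β := eWt_idem _ _
      have h7 : eTail Q (l + 3) β i 2 * emb Q (l + 2) (emb Q (l + 1) (eWt Q (l + 1) β)) =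
          eTail Q (l + 3) β i 2 := by
        rw [← (emb_emb_comm_eTail_two _ _).eq, eTail_two' (n := l + 1), ← mul_assoc, ← map_mul,
          ← map_mul, hi]
      rw [(eWt_comm β (_ * r)).eq, ← mul_assoc, hi, map_mul, map_mul, ← mul_assoc, h7]
    change _ = eTail Q (l + 3) β i 2 *
      (emb Q (l + 2) (emb Q (l + 1) (eWt Q (l + 1) β * r * eWt Q (l + 1) β)) * tau Q l _ *
        tau Q (l + 1) _ * eTail Q (l + 3) γ i 3 * _)
    rw [← T_eq, ← T_eq, mul_assoc _ (eTail Q (l + 3) γ i 3), h4]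
    have h8 : T Q (l + 3) l * T Q (l + 3) (l + 1) * eTail Q (l + 3) γ i 3 =
        T Q (l + 3) l * T Q (l + 3) (l + 1) * eTail Q (l + 3) γ i 3 * eTail Q (l + 3) γ i 3 := by
      rw [mul_assoc _ (eTail _ _ _ _ _), h5]
    rw [key, ← h3, h8, h3, ← mul_assoc (emb _ _ _), ← key]
    simp only [← mul_assoc, h6]
  · have h0 : toLeft (l + 1) β i (emb Q (l + 2) (emb Q (l + 1) r) * T Q (l + 3) l *
        T Q (l + 3) (l + 1)) = 0 := by
      refine Subtype.ext ?_
      change eTail Q (l + 3) β i 2 * (_ * eTail Q (l + 3) (β + Pi.single i 1) i 1) = 0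
      rw [key, idem_false, mul_zero, mul_zero]
      rintro ν ⟨h1, h2⟩
      obtain ⟨γ, h3⟩ := wt_three h2
      refine hγ ⟨γ, ?_⟩
      have h4 : (Pi.single i 3 : I → ℕ) = Pi.single i 1 + Pi.single i 2 := by
        rw [← Pi.single_add]
      rw [h1, h4, ← add_assoc, add_left_inj] at h3
      exact h3.symm
    rw [K.tmul, h0, TensorProduct.zero_tmul]
    exact zero_mem _

/-- Each kind of generator of `gammaPart` becomes a generator of the filtration once its right
factor has crossed the tensor sign; the cyclotomic ones become zero. Recall that `gammaAux` M is
Γ_{M-1}. -/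
theorem tmul_mem_gammaAux {M : ℕ} {y : Alg Q (n + 2)} (hy : y ∈ gammaPart Q (n + 2) a n M)
    (s : RLambda Q a (n + 1) (β + Pi.single i 1)) :
    K.tmul a β i y s ∈ gammaAux Q a n β i M := by
  refine gammaPart_le_of (tmulHom a β i s) ?_ ?_ ?_ ?_ hy
  · intro b hb r hr
    obtain ⟨r, -, rfl⟩ := exists_emb_eq le_rfl hr
    rw [tmulHom_apply, tmul_mul_emb]
    exact tmul_X_pow_mem hb _
  · intro b hb r hr
    obtain ⟨r, -, rfl⟩ := exists_emb_eq le_rfl hr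
    rw [tmulHom_apply, tmul_mul_emb]
    exact tmul_T_mul_X_pow_mem hb _
  · rintro l rfl r hr t ht
    obtain ⟨t, -, rfl⟩ := exists_emb_eq le_rfl ht
    obtain ⟨r, hr', rfl⟩ := exists_emb_eq (n := l + 2) (m := l + 1) (by omega) hr
    obtain ⟨r, -, rfl⟩ := exists_emb_eq (n := l + 1) (m := l + 1) le_rfl hr'
    rw [tmulHom_apply, tmul_mul_emb]
    exact tmul_T_mul_T_mem l M r _
  · intro w t ht
    obtain ⟨t, -, rfl⟩ := exists_emb_eq le_rfl ht
    rw [tmulHom_apply, ← emb_cycGen a (Nat.succ_pos n), mul_assoc, ← map_mul, tmul_mul_emb,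
      cls_cycGen_mul (Nat.succ_pos n), zero_mul, tmul_zero']
    exact zero_mem _

end Bimodule

/-! ### Units of degree zero. -/

section UnitDegZero

variable {k : Type*} [CommRing k] (𝒜 : ℤ → AddSubgroup k) [GradedRing 𝒜]

theorem IsUnitDegZero.one : IsUnitDegZero 𝒜 (1 : k) :=
  ⟨SetLike.GradedOne.one_mem, 1, SetLike.GradedOne.one_mem, one_mul 1⟩

variable {𝒜}

theorem mul_mem_zero {b c : k} (hb : b ∈ 𝒜 0) (hc : c ∈ 𝒜 0) : b * c ∈ 𝒜 0 := by
  have := SetLike.GradedMul.mul_mem hb hc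
  rwa [add_zero] at this

theorem IsUnitDegZero.mul {b c : k} (hb : IsUnitDegZero 𝒜 b) (hc : IsUnitDegZero 𝒜 c) :
    IsUnitDegZero 𝒜 (b * c) := by
  obtain ⟨hb, b', hb', h1⟩ := hb
  obtain ⟨hc, c', hc', h2⟩ := hc
  refine ⟨mul_mem_zero hb hc, b' * c', mul_mem_zero hb' hc', ?_⟩
  rw [mul_mul_mul_comm, h1, h2, one_mul]

theorem IsUnitDegZero.neg {c : k} (hc : IsUnitDegZero 𝒜 c) : IsUnitDegZero 𝒜 (-c) := by
  obtain ⟨hc, c', hc', h⟩ := hc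
  exact ⟨neg_mem hc, -c', neg_mem hc', by rw [neg_mul_neg, h]⟩

theorem IsUnitDegZero.pow {c : k} (hc : IsUnitDegZero 𝒜 c) (m : ℕ) : IsUnitDegZero 𝒜 (c ^ m) := by
  induction m with
  | zero => rw [pow_zero]; exact IsUnitDegZero.one 𝒜
  | succ m ih => rw [pow_succ]; exact ih.mul hc

theorem IsUnitDegZero.prod {ι : Type*} (s : Finset ι) {f : ι → k}
    (h : ∀ j ∈ s, IsUnitDegZero 𝒜 (f j)) : IsUnitDegZero 𝒜 (∏ j ∈ s, f j) :=
  Finset.prod_induction f _ (fun _ _ => IsUnitDegZero.mul) (IsUnitDegZero.one 𝒜) h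

end UnitDegZero

/-! ### Leading terms of Q_{ij} and a_i from the grading. -/

section CartanDatum

variable {I P k : Type*} [AddCommGroup P] [CommRing k] {𝒜 : ℤ → AddSubgroup k}
  {D : CartanDatum I P}

theorem CartanDatum.form_self (D : CartanDatum I P) (i : I) : D.form i i = 2 * D.d i := by
  rw [CartanDatum.form, D.diag, mul_comm]

/-- If the inequality failed, the coefficient would have negative degree and so be zero. -/
theorem QMatrix.le_of_mem_support (h𝒜 : ∀ m : ℤ, m < 0 → 𝒜 m = ⊥) (Q : QMatrix D 𝒜) {i j : I}
    (hij : i ≠ j) {u : Fin 2 →₀ ℕ} (hu : u ∈ (Q.Q i j).support) :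
    (D.d i : ℤ) * u 0 + D.d j * u 1 ≤ -((D.d i : ℤ) * D.A i j) := by
  by_contra! h
  have hm := Q.coeff_mem i j hij u
  rw [h𝒜 _ (by rw [D.form_self, D.form_self, CartanDatum.form]; linarith),
    AddSubgroup.mem_bot] at hm
  exact MvPolynomial.mem_support_iff.1 hu hm

theorem toNat_neg_A {i j : I} (hij : i ≠ j) : ((-D.A i j).toNat : ℤ) = -D.A i j :=
  Int.toNat_of_nonneg (neg_nonneg.2 (D.offDiag i j hij))

theorem QMatrix.left_le (h𝒜 : ∀ m : ℤ, m < 0 → 𝒜 m = ⊥) (Q : QMatrix D 𝒜) {i j : I}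
    (hij : i ≠ j) {u : Fin 2 →₀ ℕ} (hu : u ∈ (Q.Q i j).support) : u 0 ≤ (-D.A i j).toNat := by
  have h := Q.le_of_mem_support h𝒜 hij hu
  have h1 : (0 : ℤ) ≤ D.d j * u 1 := by positivity
  have h2 : (0 : ℤ) < D.d i := by exact_mod_cast D.d_pos i
  have h3 : (D.d i : ℤ) * u 0 ≤ D.d i * (-D.A i j) := by linarith
  have h4 := le_of_mul_le_mul_left h3 h2
  rw [← toNat_neg_A hij] at h4
  exact_mod_cast h4

/-- Symmetrizability turns the degree bound into d_j p + d_i q ≤ -d_i a_{ij}, for the exponents p of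
u and q of v. Equality q = -a_{ij} leaves no room for u, since d_j > 0. -/
theorem QMatrix.right_lt (h𝒜 : ∀ m : ℤ, m < 0 → 𝒜 m = ⊥) (Q : QMatrix D 𝒜) {i j : I}
    (hij : i ≠ j) {u : Fin 2 →₀ ℕ} (hu : u ∈ (Q.Q j i).support) :
    u 1 < (-D.A i j).toNat ∨ u = Finsupp.single 1 (-D.A i j).toNat := by
  have h := Q.le_of_mem_support h𝒜 hij.symm hu
  rw [D.symmetrizable j i] at h
  have h1 : (0 : ℤ) ≤ D.d j * u 0 := by positivity
  have h2 : (0 : ℤ) < D.d i := by exact_mod_cast D.d_pos i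
  have h2' : (0 : ℤ) < D.d j := by exact_mod_cast D.d_pos j
  have h3 : (D.d i : ℤ) * u 1 ≤ D.d i * (-D.A i j) := by linarith
  have h4 := le_of_mul_le_mul_left h3 h2
  rw [← toNat_neg_A hij] at h4
  have h5 : u 1 ≤ (-D.A i j).toNat := by exact_mod_cast h4
  refine h5.lt_or_eq.imp_right fun h6 => ?_
  have h7 : (D.d j : ℤ) * u 0 ≤ 0 := by
    rw [h6, toNat_neg_A hij] at h
    linarith
  have h8 : (u 0 : ℤ) ≤ 0 := by
    by_contra! h9
    have := mul_pos h2' h9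
    omega
  have h9 : u 0 = 0 := by omega
  ext l
  fin_cases l
  · simpa using h9
  · simpa using h6

/-- Exchanging the variables, this coefficient is t_{i,j;-a_{ij},0}. -/
theorem QMatrix.coeff_right_unit (Q : QMatrix D 𝒜) {i j : I} (hij : i ≠ j) :
    IsUnitDegZero 𝒜 ((Q.Q j i).coeff (Finsupp.single 1 (-D.A i j).toNat)) := by
  have h := Q.coeff_unit i j hij
  rw [Q.symm i j] at h
  have e : (Finsupp.single 0 (-D.A i j).toNat : Fin 2 →₀ ℕ) =
      Finsupp.mapDomain (Equiv.swap (0 : Fin 2) 1) (Finsupp.single 1 (-D.A i j).toNat) := by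
    rw [Finsupp.mapDomain_single, Equiv.swap_apply_right]
  rwa [e, MvPolynomial.coeff_rename_mapDomain _ (Equiv.injective _)] at h

theorem CycCoeff.poly_eq {Λ : P} (a : CycCoeff D 𝒜 Λ) (i : I) :
    ∃ r : ℕ → k, a.poly i = ∑ b ∈ Finset.range (D.coroot i Λ).toNat, Polynomial.monomial b (r b) +
      Polynomial.monomial (D.coroot i Λ).toNat 1 := by
  refine ⟨fun b => a.c i ((D.coroot i Λ).toNat - b), ?_⟩
  rw [CycCoeff.poly, Finset.sum_range_succ', a.zero, Nat.sub_zero, ← Finset.sum_range_reflect]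
  congr 1
  refine Finset.sum_congr rfl fun b hb => ?_
  have := Finset.mem_range.1 hb
  rw [(by omega : (D.coroot i Λ).toNat - ((D.coroot i Λ).toNat - 1 - b + 1) = b),
    (by omega : (D.coroot i Λ).toNat - 1 - b + 1 = (D.coroot i Λ).toNat - b)]

theorem QMatrix.leadingData [Fintype I] [DecidableEq I] (h𝒜 : ∀ m : ℤ, m < 0 → 𝒜 m = ⊥)
    (Q : QMatrix D 𝒜) {Λ : P} (a : CycCoeff D 𝒜 Λ) (i : I) :
    LeadingData Q.Q a.poly i (D.coroot i Λ).toNat (fun j => (-D.A i j).toNat)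
      fun j => (Q.Q j i).coeff (Finsupp.single 1 (-D.A i j).toNat) where
  diag := Q.diag i
  lead := a.poly_eq i
  right _ hj _ hu := Q.right_lt h𝒜 hj.symm hu
  coeff _ _ := rfl
  left _ hj _ hu := Q.left_le h𝒜 hj.symm hu

end CartanDatum

/-! ### Dependence on β alone, and assembly in K. -/

section Weights

variable {I k : Type*} [Fintype I] [DecidableEq I] [CommRing k]

/-- Makes the leading coefficient, and in additive form the leading degree, independent of the
choice of ν in I^β. -/
theorem prod_range_eq_prod_pow {M : Type*} [CommMonoid M] (g : I → M) {n : ℕ} {ν : ℕ → I}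
    {β : I → ℕ} (h : wt (fun l : Fin n => ν l) = β) :
    ∏ l ∈ Finset.range n, g (ν l) = ∏ j, g j ^ β j := by
  rw [← h, Finset.prod_range]
  simp only [wt, Finset.sum_apply]
  simp_rw [← Finset.prod_pow_eq_pow_sum]
  rw [Finset.prod_comm]
  refine Finset.prod_congr rfl fun l _ => ?_
  rw [Finset.prod_eq_single (ν l)]
  · simp
  · intro j _ hj
    rw [Pi.single_eq_of_ne hj, pow_zero]
  · simp

theorem sum_range_eq_sum_mul (g : I → ℕ) {n : ℕ} {ν : ℕ → I} {β : I → ℕ}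
    (h : wt (fun l : Fin n => ν l) = β) :
    ∑ l ∈ Finset.range n, g (ν l) = ∑ j, β j * g j := by
  have := prod_range_eq_prod_pow (fun j => Multiplicative.ofAdd (g j)) h
  simp only [← ofAdd_sum, ← ofAdd_nsmul, smul_eq_mul] at this
  exact Multiplicative.ofAdd.injective this

theorem wt_of_wt_add_two {n : ℕ} {ν : ℕ → I} {β : I → ℕ} {i : I} (h1 : ν n = i)
    (h2 : ν (n + 1) = i) (h : wt (fun l : Fin (n + 2) => ν l) = β + Pi.single i 2) :
    wt (fun l : Fin n => ν l) = β := by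
  rw [wt_init, wt_init] at h
  change wt (fun l : Fin n => ν l) + Pi.single (ν n) 1 + Pi.single (ν (n + 1)) 1 = _ at h
  rwa [h1, h2, add_assoc, ← Pi.single_add, add_left_inj] at h

variable {Q : I → I → MvPolynomial (Fin 2) k} {n : ℕ} {a : I → Polynomial k} {β : I → ℕ} {i : I}

theorem theta_eq_prod (N m : ℕ) :
    theta Q N a m = (List.ofFn fun l : Fin m => T Q N l).reverse.prod * cycGen Q N a *
      (List.ofFn fun l : Fin m => T Q N l).prod := by
  induction m with
  | zero => simp [theta]
  | succ m ih =>
    rw [theta, ih, List.ofFn_succ']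
    simp [mul_assoc]

theorem tauUp_eq : tauUp Q n = (List.ofFn fun l : Fin (n + 1) => T Q (n + 2) l).prod := by
  rw [tauUp]
  congr 2
  funext l
  exact (T_eq _).symm

theorem tauDown_eq :
    tauDown Q n = (List.ofFn fun l : Fin (n + 1) => T Q (n + 2) l).reverse.prod := by
  rw [tauDown]
  congr 3
  funext l
  exact (T_eq _).symm

theorem tauDown_mul_cyc_mul_tauUp (b : ℕ) :
    tauDown Q n * cyc Q a (β + Pi.single i 2) (0 : Fin (n + 2)) * tauUp Q n *
        eTail Q (n + 2) β i 2 * x Q (Fin.last (n + 1)) ^ b =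
      theta Q (n + 2) a (n + 1) * X Q (n + 2) (n + 1) ^ b * eTail Q (n + 2) β i 2 := by
  have h1 : cyc Q a (β + Pi.single i 2) (0 : Fin (n + 2)) = _ := cyc_eq a _ (Nat.succ_pos _)
  have h2 : eWt Q (n + 2) (β + Pi.single i 2) * eTail Q (n + 2) β i 2 = eTail Q (n + 2) β i 2 := by
    rw [eTail_two, ← mul_assoc, eWt_idem]
  have h3 : x Q (Fin.last (n + 1)) = X Q (n + 2) (n + 1) := (X_eq _).symm
  have h4 : Commute (X Q (n + 2) (n + 1)) (eTail Q (n + 2) β i 2) := X_comm_idem _ _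
  rw [h1, h3, theta_eq_prod, ← tauUp_eq, ← tauDown_eq, ← mul_assoc (tauDown Q n),
    mul_assoc _ (eWt _ _ _) (tauUp Q n), ← (eWt_comm _ (tauUp Q n)).eq, ← mul_assoc _ (tauUp Q n),
    mul_assoc _ (eWt _ _ _), h2, mul_assoc _ (eTail _ _ _ _ _), mul_assoc _ (X _ _ _ ^ b),
    (h4.pow_left b).eq]

/-- Presents e(ν) as the image of an element of R(n+1) up to the last colour, so that it can cross
the tensor sign. -/
theorem E_eq {ν : ℕ → I} (h : ν (n + 1) = i) :
    E Q (n + 2) ν = emb Q (n + 1) (E Q (n + 1) ν) * F Q (n + 2) (n + 1) i := by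
  have h1 : ∀ N, E Q N ν = idem Q N fun μ => μ = fun l : Fin N => ν l := fun N => by
    rw [idem, Finset.sum_filter]
    simp [E]
  rw [h1, h1, emb_idem, F, idem_mul_idem]
  refine idem_congr fun μ => ⟨?_, ?_⟩
  · rintro rfl
    exact ⟨rfl, fun _ => h⟩
  · rintro ⟨h2, h3⟩
    funext l
    induction l using Fin.lastCases with
    | last => exact (h3 (by omega)).trans h.symm
    | cast l => exact congrFun h2 l

/-- Expand e(β, i²) into the e(ν). On each of them `theta_succ_self` leaves the error -c y; the
hypothesis on c cancels the leading coefficient for all ν at once. -/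
theorem tmul_leading_sub_mem {L : ℕ} {d : I → ℕ} {t : I → k} (h : LeadingData Q a i L d t) {c : k}
    (hc : c * -∏ j, (if j = i then -1 else t j) ^ β j = 1) {M : ℕ}
    (hM : M = L + ∑ j, β j * if j = i then 0 else d j) :
    K.tmul a β i (T Q (n + 2) n * X Q (n + 2) (n + 1) ^ (M + 1) * eTail Q (n + 2) β i 2) 1 -
      K.tmul a β i (c • (theta Q (n + 2) a (n + 1) * X Q (n + 2) (n + 1) ^ (2 * β i + 2) *
        eTail Q (n + 2) β i 2)) 1 ∈ gammaAux Q a n β i M := by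
  rw [← tmulHom_apply, ← tmulHom_apply, ← map_sub, ← smul_mul_assoc, ← sub_mul, eTail,
    Finset.mul_sum, map_sum]
  refine sum_mem fun μ hμ => ?_
  obtain ⟨hwt, htail⟩ := (Finset.mem_filter.1 hμ).2
  -- The value beyond the end of the sequence is irrelevant: e(ν) only sees the first n+2 entries.
  obtain ⟨ν, rfl⟩ : ∃ ν : ℕ → I, μ = fun l : Fin (n + 2) => ν l :=
    ⟨fun l => if hl : l < n + 2 then μ ⟨l, hl⟩ else i, by funext l; simp⟩
  have h1 : ν n = i := htail ⟨n, by omega⟩ le_rfl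
  have h2 : ν (n + 1) = i := htail ⟨n + 1, by omega⟩ (by simp)
  have hβ := wt_of_wt_add_two h1 h2 hwt
  obtain ⟨y, hy, hθ⟩ := theta_succ_self h (by omega : n + 1 < n + 2) h2 h1
    (hasLeadingTerm h n (by omega) ν h1)
  have e1 : cnt i ν n = β i := by
    rw [cnt, sum_range_eq_sum_mul (fun j => if j = i then 1 else 0) hβ]
    simp
  have e2 : topDeg i L d ν n = M := by
    rw [topDeg, sum_range_eq_sum_mul (fun j => if j = i then 0 else d j) hβ, hM]
  have e3 : c * -topCoeff i t ν n = 1 := by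
    rw [topCoeff, prod_range_eq_prod_pow (fun j => if j = i then -1 else t j) hβ, hc]
  rw [e1, e2] at hθ
  rw [e2] at hy
  change tmulHom a β i 1 (_ * E Q (n + 2) ν) ∈ _
  have e4 : (T Q (n + 2) n * X Q (n + 2) (n + 1) ^ (M + 1) -
      c • (theta Q (n + 2) a (n + 1) * X Q (n + 2) (n + 1) ^ (2 * β i + 2))) * E Q (n + 2) ν =
      y * emb Q (n + 1) (-c • E Q (n + 1) ν) * F Q (n + 2) (n + 1) i := by
    rw [map_smul, mul_smul_comm, smul_mul_assoc, mul_assoc y, ← E_eq h2, sub_mul, smul_mul_assoc,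
      hθ, add_mul, smul_add, neg_mul, smul_mul_assoc, smul_neg, smul_smul, ← neg_smul,
      ← mul_neg, e3, one_smul, neg_smul, sub_add_cancel_left]
  rw [e4, tmulHom_apply, tmul_mul_F, tmul_mul_emb]
  exact tmul_mem_gammaAux hy _

end Weights

end

end KLR

/-! ### The identity M = λ_i + 2p and the choice of c. -/

/-- Here `β i` is the number `p` of times that `α_i` occurs in `β`, the integer `lam` is
`λ_i = ⟨h_i, Λ - β⟩`, and an element `w` of `e(β, i²) R(β + 2α_i) e(β + α_i, i)` is regarded as the
element `w ⊗ 1` of `K`. -/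
theorem proposition5p7 {I P k : Type*} [Fintype I] [DecidableEq I]
    [AddCommGroup P] [Module.Free ℤ P] [Module.Finite ℤ P]
    [CommRing k] (𝒜 : ℤ → AddSubgroup k) [GradedRing 𝒜] (h𝒜 : ∀ m : ℤ, m < 0 → 𝒜 m = ⊥)
    (D : KLR.CartanDatum I P) (Q : KLR.QMatrix D 𝒜)
    (Λ : P) (hΛ : D.IsDominant Λ) (a : KLR.CycCoeff D 𝒜 Λ)
    (β : I → ℕ) (n : ℕ) (hn : ∑ j, β j = n) (i : I)
    (lam : ℤ) (hlam : lam = D.coroot i (Λ - D.toWeight β)) :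
    0 ≤ lam + 2 * (β i : ℤ) ∧
    ∃ c : k, KLR.IsUnitDegZero 𝒜 c ∧
      KLR.K.tmul a.poly β i
          (KLR.tau Q.Q n (by omega) *
            KLR.x Q.Q (Fin.last (n + 1)) ^ (lam + 2 * (β i : ℤ) + 1).toNat *
            KLR.eTail Q.Q (n + 2) β i 2) 1 -
        KLR.K.tmul a.poly β i
          (c • (KLR.tauDown Q.Q n *
            KLR.cyc Q.Q a.poly (β + Pi.single i 2) (0 : Fin (n + 2)) *
            KLR.tauUp Q.Q n *
            KLR.eTail Q.Q (n + 2) β i 2 *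
            KLR.x Q.Q (Fin.last (n + 1)) ^ (2 * β i + 2))) 1
      ∈ KLR.gamma Q.Q a.poly n β i (lam + 2 * (β i : ℤ) - 1) := by
  obtain ⟨M, hM⟩ : ∃ M : ℕ, M = (D.coroot i Λ).toNat +
    ∑ j, β j * if j = i then 0 else (-D.A i j).toNat := ⟨_, rfl⟩
  have hlamM : lam + 2 * (β i : ℤ) = M := by
    -- Since a_{ii} = 2, the term j = i of -⟨h_i, β⟩ is -2p; adding 2p removes it, and the remaining
    -- terms are nonnegative.
    have h1 : ∀ j, (β j : ℤ) * (if j = i then 0 else ((-D.A i j).toNat : ℤ)) =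
        -((β j : ℤ) * D.A i j) + if j = i then 2 * (β i : ℤ) else 0 := by
      intro j
      by_cases hj : j = i
      · subst hj
        simp [D.diag, mul_comm]
      · rw [if_neg hj, if_neg hj, KLR.toNat_neg_A (Ne.symm hj), mul_neg, add_zero]
    rw [hM, Nat.cast_add, Int.toNat_of_nonneg (hΛ i), hlam, map_sub, KLR.CartanDatum.toWeight,
      map_sum]
    push_cast
    simp only [h1, Finset.sum_add_distrib, map_nsmul, D.pairing, nsmul_eq_mul,
      Finset.sum_neg_distrib, Finset.sum_ite_eq', Finset.mem_univ, if_true]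
    ring
  refine ⟨by omega, ?_⟩
  have hu : KLR.IsUnitDegZero 𝒜 (-∏ j, (if j = i then -1 else
      (Q.Q j i).coeff (Finsupp.single 1 (-D.A i j).toNat)) ^ β j) := by
    refine (KLR.IsUnitDegZero.prod _ fun j _ => KLR.IsUnitDegZero.pow ?_ _).neg
    split_ifs with hj
    · exact (KLR.IsUnitDegZero.one 𝒜).neg
    · exact Q.coeff_right_unit (Ne.symm hj)
  -- The constant is the inverse of minus the leading coefficient of θ_n.
  obtain ⟨hu, c, hc, huc⟩ := hu
  refine ⟨c, ⟨hc, _, hu, by rw [mul_comm, huc]⟩, ?_⟩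
  -- The index M - 1 is at least -1, so the zero branch of `gamma` is not taken, and Γ_{M-1} is
  -- `gammaAux` M.
  rw [KLR.tauDown_mul_cyc_mul_tauUp, KLR.gamma, if_neg (by omega), hlamM, ← KLR.T_eq]
  have h := KLR.tmul_leading_sub_mem (n := n) (Q.leadingData h𝒜 a i) ((mul_comm _ _).trans huc) hM
  have h3 : KLR.x Q.Q (Fin.last (n + 1)) = KLR.X Q.Q (n + 2) (n + 1) := (KLR.X_eq _).symm
  rw [h3, (by omega : ((M : ℤ) + 1).toNat = M + 1), (by omega : ((M : ℤ) - 1 + 1).toNat = M)]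
  exact h
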